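/- Let $\mathcal X\subset\mathbb R^d$ be a finite set with $\mathrm{span}(\mathcal X)=\mathbb R^d$, let $\mathcal Z\subset\mathbb R^d$ be finite, and let $\Sigma^*\in\mathbb R^{d\times d}$ be positive semidefinite with $\sigma_x^2:=x^\top\Sigma^*x>0$ for all $x\in\mathcal X$. Probing $x\in\mathcal X$ under the parameter $\theta\in\mathbb R^d$ yields $y=x^\top\theta+\eta$ with independent noise $\eta\sim\mathcal N(0,\sigma_x^2)$; the variances are known and $\theta$ is not. An algorithm is a (possibly randomized) sampling strategy that chooses each measurement vector in $\mathcal X$ from the past, together with a rule that stops at a time $\tau$ depending on the past only (the number of samples taken, $\tau=\infty$ being allowed) and then returns a set $\widehat{\mathcal H}$. Let $\mathrm{OBJ}$ be best-arm identification ($\mathrm{BAI}$) or level-set identification ($\mathrm{LS}$) with threshold $\alpha\in\mathbb R$. For $\mathrm{BAI}$ let $\Theta$ be the set of all $\theta\in\mathbb R^d$ for which $z^*(\theta)=\arg\max_{z\in\mathcal Z}z^\top\theta$ is unique, and put $\mathcal H_{\mathrm{OBJ}}(\theta)=\{z^*(\theta)\}$, $\mathcal Q_{\mathrm{OBJ}}(\theta)=\mathcal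 Z\setminus\{z^*(\theta)\}$, $b_{\mathrm{OBJ}}=0$. For $\mathrm{LS}$ let $\Theta$ be the set of all $\theta\in\mathbb R^d$ with $z^\top\theta\ne\alpha$ for all $z\in\mathcal Z$, and put $\mathcal H_{\mathrm{OBJ}}(\theta)=\{z\in\mathcal Z: z^\top\theta>\alpha\}$, $\mathcal Q_{\mathrm{OBJ}}(\theta)=\{0\}$, $b_{\mathrm{OBJ}}=\alpha$. For $\delta\in(0,1)$, an algorithm is $\delta$-PAC for $\mathrm{OBJ}$ if for every $\theta\in\Theta$, with $P_\theta$-probability at least $1-\delta$, it stops and returns $\widehat{\mathcal H}=\mathcal H_{\mathrm{OBJ}}(\theta)$. Then for every $\delta\in(0,1)$, every $\delta$-PAC algorithm for $\mathrm{OBJ}$ and every $\theta\in\Theta$, $$E_\theta[\tau]\ \ge\ 2\log\!\Big(\frac1{2.4\,\delta}\Big)\,\psi^*_{\mathrm{OBJ}}(\theta),\qquad \psi^*_{\mathrm{OBJ}}(\theta)=\inf_{\lambda}\ \max_{h\in\mathcal H_{\mathrm{OBJ}}(\theta),\,q\in\mathcal Q_{\mathrm{OBJ}}(\theta)}\frac{(h-q)^\top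 A(\lambda)^{-1}(h-q)}{\big((h-q)^\top\theta-b_{\mathrm{OBJ}}\big)^2},\qquad A(\lambda)=\sum_{x\in\mathcal X}\lambda_x\sigma_x^{-2}xx^\top,$$ where $\lambda$ ranges over the probability vectors on $\mathcal X$ for which $A(\lambda)$ is invertible, and a maximum over no pair $(h,q)$ is $0$. (If the logarithm is negative, the inequality is trivial.) -/

import Mathlib

open MeasureTheory ProbabilityTheory Matrix
open scoped ENNReal

namespace HetBandit

/-- The identification objective: best-arm identification, or level-set identification with
threshold `α`. -/
inductive Objective where
  | BAI : Objective
  | LS (α : ℝ) : Objective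

/-- The set `H_OBJ(θ)` to be identified among the items `Z`: the maximizers of `zᵀθ` for `BAI`,
and `{z ∈ Z : zᵀθ > α}` for `LS α`. -/
def Objective.target {d : ℕ} (Z : Finset (Fin d → ℝ)) (θ : Fin d → ℝ) :
    Objective → Set (Fin d → ℝ)
  | .BAI => {z | z ∈ Z ∧ ∀ z' ∈ Z, z' ⬝ᵥ θ ≤ z ⬝ᵥ θ}
  | .LS α => {z | z ∈ Z ∧ α < z ⬝ᵥ θ}

/-- The comparison set `Q_OBJ(θ)`: the items other than the best one for `BAI`, and `{0}` for
`LS α`. -/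
def Objective.comparison {d : ℕ} (Z : Finset (Fin d → ℝ)) (θ : Fin d → ℝ) :
    Objective → Set (Fin d → ℝ)
  | .BAI => {z | z ∈ Z ∧ z ∉ Objective.target Z θ .BAI}
  | .LS _ => {0}

/-- The constant `b_OBJ`. -/
def Objective.offset : Objective → ℝ
  | .BAI => 0
  | .LS α => α

/-- The parameters `Θ` for which the identification problem is well posed: the best item is
unique (`BAI`), respectively no item lies exactly on the threshold (`LS α`). -/
def Objective.params {d : ℕ} (Z : Finset (Fin d → ℝ)) : Objective → Set (Fin d → ℝ)
  | .BAI => {θ | ∃! z, z ∈ Objective.target Z θ .BAI}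
  | .LS α => {θ | ∀ z ∈ Z, z ⬝ᵥ θ ≠ α}

/-- The noise variance `σ_x² = xᵀ Σ x`. -/
def noiseVar {d : ℕ} (S : Matrix (Fin d) (Fin d) ℝ) (x : Fin d → ℝ) : ℝ :=
  x ⬝ᵥ (S *ᵥ x)

/-- The information matrix `∑_{x ∈ X} λ_x σ_x⁻² x xᵀ` of a design `λ`. -/
noncomputable def infoMatrix {d : ℕ} (X : Finset (Fin d → ℝ)) (S : Matrix (Fin d) (Fin d) ℝ)
    (l : X → ℝ) : Matrix (Fin d) (Fin d) ℝ :=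
  ∑ x : X, (l x * (noiseVar S x)⁻¹) • vecMulVec (x : Fin d → ℝ) (x : Fin d → ℝ)

/-- The complexity `ψ*_OBJ`: the infimum, over the designs `λ` in the simplex over `X` whose
information matrix `A(λ)` is invertible, of the maximum over `h ∈ H_OBJ`, `q ∈ Q_OBJ` of
`‖h - q‖²_{A(λ)⁻¹} / ((h - q)ᵀθ - b_OBJ)²` (a maximum over no pair being `0`). -/
noncomputable def complexity {d : ℕ} (X Z : Finset (Fin d → ℝ)) (S : Matrix (Fin d) (Fin d) ℝ)
    (θ : Fin d → ℝ) (obj : Objective) : ℝ≥0∞ :=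
  ⨅ l ∈ stdSimplex ℝ X, ⨅ _ : IsUnit (infoMatrix X S l),
    ⨆ h ∈ obj.target Z θ, ⨆ q ∈ obj.comparison Z θ,
      ENNReal.ofReal (((h - q) ⬝ᵥ ((infoMatrix X S l)⁻¹ *ᵥ (h - q))) /
        ((h - q) ⬝ᵥ θ - obj.offset) ^ 2)

/-- A possibly randomized sequential algorithm with arms `X`. Its internal randomness is a random
seed in `U`. After `t` observations it knows its seed and the observed responses (and thereby the
arms pulled so far, which are functions of these). On this information, `rule t` either is `none`
(the algorithm goes on) or is `some H` (it stops and returns the set `H`), and `arm t` is the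
measurement vector probed next if it goes on. -/
structure Algorithm {d : ℕ} (X : Finset (Fin d → ℝ)) (U : Type*) [MeasurableSpace U] where
  /-- the law of the seed -/
  seed : Measure U
  isProbabilityMeasure_seed : IsProbabilityMeasure seed
  /-- the sampling strategy -/
  arm : (t : ℕ) → U × (Fin t → ℝ) → X
  measurable_arm : ∀ t, Measurable (arm t)
  /-- the stopping and recommendation rule -/
  rule : (t : ℕ) → U × (Fin t → ℝ) → Option (Set (Fin d → ℝ))
  measurableSet_rule : ∀ t o, MeasurableSet {h | rule t h = o}

namespace Algorithm

variable {d : ℕ} {X : Finset (Fin d → ℝ)} {U : Type*} [MeasurableSpace U]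

/-- The probability space: the seed together with independent noise variables
`η_{t,x} ∼ N(0, σ_x²)`, of which `η_{t,x}` is the noise added if `x` is probed at time `t`. -/
noncomputable def prob (alg : Algorithm X U) (S : Matrix (Fin d) (Fin d) ℝ) :
    Measure (U × (ℕ → X → ℝ)) :=
  alg.seed.prod (Measure.infinitePi fun _ : ℕ =>
    Measure.pi fun x : X => gaussianReal 0 (noiseVar S x).toNNReal)

/-- The first `t` observations under the parameter `θ`, where probing `x` at time `t` yields
`xᵀθ + η_{t,x}`. -/
noncomputable def obs (alg : Algorithm X U) (θ : Fin d → ℝ) (ω : U × (ℕ → X → ℝ)) :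
    (t : ℕ) → Fin t → ℝ
  | 0 => Fin.elim0
  | t + 1 =>
    Fin.snoc (α := fun _ => ℝ) (obs alg θ ω t)
      (((alg.arm t (ω.1, obs alg θ ω t) : X) : Fin d → ℝ) ⬝ᵥ θ
        + ω.2 t (alg.arm t (ω.1, obs alg θ ω t)))

/-- The outcome of the rule after `t` observations under the parameter `θ`. -/
noncomputable def outcome (alg : Algorithm X U) (θ : Fin d → ℝ) (ω : U × (ℕ → X → ℝ)) (t : ℕ) :
    Option (Set (Fin d → ℝ)) :=
  alg.rule t (ω.1, alg.obs θ ω t)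

/-- The stopping time `τ`, i.e. the number of samples taken (`⊤` if the algorithm never stops). -/
noncomputable def tau (alg : Algorithm X U) (θ : Fin d → ℝ) (ω : U × (ℕ → X → ℝ)) : ℕ∞ :=
  ⨅ (t : ℕ) (_ : alg.outcome θ ω t ≠ none), (t : ℕ∞)

/-- The event that the algorithm stops and returns the set `H`. -/
def Returns (alg : Algorithm X U) (θ : Fin d → ℝ) (H : Set (Fin d → ℝ))
    (ω : U × (ℕ → X → ℝ)) : Prop :=
  ∃ t : ℕ, alg.tau θ ω = t ∧ alg.outcome θ ω t = some H

/-- `δ`-PAC: for every `θ ∈ Θ`, the set returned is `H_OBJ(θ)` with probability at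
least `1 - δ`. -/
def IsPAC (alg : Algorithm X U) (S : Matrix (Fin d) (Fin d) ℝ) (Z : Finset (Fin d → ℝ))
    (obj : Objective) (δ : ℝ) : Prop :=
  ∀ θ ∈ obj.params Z,
    ENNReal.ofReal (1 - δ) ≤ alg.prob S {ω | alg.Returns θ (obj.target Z θ) ω}

/-- The expected stopping time `E_θ[τ] ∈ [0, ∞]`. -/
noncomputable def expectedTau (alg : Algorithm X U) (S : Matrix (Fin d) (Fin d) ℝ)
    (θ : Fin d → ℝ) : ℝ≥0∞ :=
  ∫⁻ ω, (alg.tau θ ω : ℝ≥0∞) ∂(alg.prob S)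

end Algorithm

end HetBandit

namespace HetBandit

/-! The proof is a change-of-measure argument. If `θ'` is well posed and has a different target set,
a δ-PAC algorithm returns the target of `θ` with probability at least 1 - δ under `θ` and at most δ
under `θ'`. The data must therefore carry enough information to tell the two parameters apart: with
T_x the expected number of pulls of x under `θ`, `IsPAC.log_le_of_target_ne` gives log(1/(2.4δ)) ≤ ∑
T_x (xᵀ(θ-θ'))²/(2σ_x²). This combines the variational inequality `le_sum_expectedPulls`, for the
test function c·1{H returned}, with a numerical bound on the binary relative entropy.

The likelihood ratio is handled only at fixed horizons n. The stopped exponential splits into terms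
that depend on histories of fixed length, each of which changes measure separately; Jensen's
inequality and n → ∞ finish. No optional stopping theorem is needed.

By perturbation and continuity, the inequality extends to every θ₀ on a hyperplane (h-q)ᵀθ₀ = b with
h ≠ q. With w = h - q, the choice θ₀ = θ - kA(λ)⁻¹w, the projection of θ onto that hyperplane in the
A(λ)-norm, turns the sum into the ratio defining ψ*, provided T_x ≤ sλ_x. Taking λ proportional to
the expected pulls, slightly smoothed so that A(λ) is invertible, makes s arbitrarily close to ∑ T_x
≤ E[τ]. One design then serves all pairs (h, q), as the infimum over λ requires. -/

/-! ### Gaussian responses and the likelihood ratio of one observation -/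

/-- The joint law of the noise variables of one round. -/
noncomputable def roundNoise {d : ℕ} (X : Finset (Fin d → ℝ)) (S : Matrix (Fin d) (Fin d) ℝ) :
    Measure (X → ℝ) :=
  Measure.pi fun x : X => gaussianReal 0 (noiseVar S x).toNNReal

instance {d : ℕ} (X : Finset (Fin d → ℝ)) (S : Matrix (Fin d) (Fin d) ℝ) :
    IsProbabilityMeasure (roundNoise X S) := by
  unfold roundNoise; infer_instance

lemma lintegral_roundNoise_eval {d : ℕ} {X : Finset (Fin d → ℝ)} (S : Matrix (Fin d) (Fin d) ℝ)
    (x : X) {f : ℝ → ℝ≥0∞} (hf : Measurable f) (m : ℝ) :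
    ∫⁻ η, f (m + η x) ∂(roundNoise X S)
      = ∫⁻ y, f y ∂(gaussianReal m (noiseVar S x).toNNReal) := by
  have h1 : (roundNoise X S).map (fun η => η x) = gaussianReal 0 (noiseVar S x).toNNReal :=
    (measurePreserving_eval (fun x : X => gaussianReal 0 (noiseVar S x).toNNReal) x).map_eq
  have h2 : (roundNoise X S).map (fun η => m + η x)
      = gaussianReal m (noiseVar S x).toNNReal := by
    have := gaussianReal_map_const_add (μ := 0) (v := (noiseVar S x).toNNReal) m
    rw [← h1, Measure.map_map (by fun_prop) (by fun_prop)] at this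
    simpa [Function.comp_def, add_comm, h1] using this
  rw [← h2, lintegral_map hf (by fun_prop)]

/-- The log-likelihood ratio, under `N(a, v)` versus `N(b, v)`, of an observation `y`. -/
noncomputable def gaussianLLR (a b v y : ℝ) : ℝ := ((y - b) ^ 2 - (y - a) ^ 2) / (2 * v)

lemma measurable_gaussianLLR (a b v : ℝ) : Measurable (gaussianLLR a b v) := by
  unfold gaussianLLR; fun_prop

/-- The quotient of the two Gaussian densities is exp(-LLR); positive variance guarantees that the
densities exist. -/
lemma lintegral_gaussianReal_change {v : ℝ} (hv : 0 < v) (a b : ℝ) {f : ℝ → ℝ≥0∞}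
    (hf : Measurable f) :
    ∫⁻ y, f y ∂(gaussianReal b v.toNNReal)
      = ∫⁻ y, f y * ENNReal.ofReal (Real.exp (-gaussianLLR a b v y))
          ∂(gaussianReal a v.toNNReal) := by
  have hv' : v.toNNReal ≠ 0 := by simpa using hv
  have hg : Measurable fun y => ENNReal.ofReal (Real.exp (-gaussianLLR a b v y)) :=
    (Real.measurable_exp.comp (measurable_gaussianLLR a b v).neg).ennreal_ofReal
  rw [gaussianReal_of_var_ne_zero _ hv', gaussianReal_of_var_ne_zero _ hv',
    lintegral_withDensity_eq_lintegral_mul _ (measurable_gaussianPDF _ _) hf,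
    lintegral_withDensity_eq_lintegral_mul _ (measurable_gaussianPDF _ _)
      (show Measurable fun y => f y * ENNReal.ofReal (Real.exp (-gaussianLLR a b v y)) from
        hf.mul hg)]
  refine lintegral_congr fun y => ?_
  have : gaussianPDF b v.toNNReal y
      = gaussianPDF a v.toNNReal y * ENNReal.ofReal (Real.exp (-gaussianLLR a b v y)) := by
    unfold gaussianPDF
    rw [← ENNReal.ofReal_mul (gaussianPDFReal_nonneg _ _ _)]
    congr 1
    unfold gaussianPDFReal gaussianLLR
    have hexp : ∀ c p q : ℝ, c * Real.exp p * Real.exp q = c * Real.exp (p + q) := by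
      intro c p q; rw [Real.exp_add, mul_assoc]
    rw [hexp, Real.coe_toNNReal _ hv.le]
    congr 2
    field_simp
    ring
  simp only [Pi.mul_apply, this]
  ring

/-- The log-likelihood ratio, under `θ` versus `θ'`, of a response `y` to the arm `x`. -/
noncomputable def armLLR {d : ℕ} (S : Matrix (Fin d) (Fin d) ℝ) (θ θ' x : Fin d → ℝ) (y : ℝ) : ℝ :=
  gaussianLLR (x ⬝ᵥ θ) (x ⬝ᵥ θ') (noiseVar S x) y

/-! ### Histories and the independence of fresh noise -/

namespace Algorithm

variable {d : ℕ} {X : Finset (Fin d → ℝ)} {U : Type*} [MeasurableSpace U]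

/-- The information available after `t` observations. -/
noncomputable def history (alg : Algorithm X U) (θ : Fin d → ℝ) (t : ℕ)
    (ω : U × (ℕ → X → ℝ)) : U × (Fin t → ℝ) := (ω.1, alg.obs θ ω t)

instance (alg : Algorithm X U) (S : Matrix (Fin d) (Fin d) ℝ) :
    IsProbabilityMeasure (alg.prob S) := by
  have := alg.isProbabilityMeasure_seed
  unfold prob; infer_instance

lemma measurable_apply_arm : Measurable fun p : (X → ℝ) × X => p.1 p.2 :=
  measurable_from_prod_countable_left fun x => measurable_pi_apply x

lemma measurable_snoc (t : ℕ) :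
    Measurable fun p : (Fin t → ℝ) × ℝ => (Fin.snoc (α := fun _ => ℝ) p.1 p.2 : Fin (t+1) → ℝ) := by
  refine measurable_pi_lambda _ fun i => ?_
  refine Fin.lastCases ?_ (fun i => ?_) i
  · simpa using measurable_snd
  · simpa [Function.comp_def] using
      (measurable_pi_apply i).comp (measurable_fst (α := Fin t → ℝ) (β := ℝ))

lemma measurable_init (t : ℕ) :
    Measurable fun p : U × (Fin (t+1) → ℝ) => ((p.1, Fin.init p.2) : U × (Fin t → ℝ)) := by
  refine measurable_fst.prodMk (measurable_pi_lambda _ fun i => ?_)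
  exact (measurable_pi_apply i.castSucc).comp measurable_snd

/-- The response in round `t`, given the history and the noise of that round. -/
noncomputable def response (alg : Algorithm X U) (θ : Fin d → ℝ) (t : ℕ)
    (p : (U × (Fin t → ℝ)) × (X → ℝ)) : ℝ :=
  ((alg.arm t p.1 : X) : Fin d → ℝ) ⬝ᵥ θ + p.2 (alg.arm t p.1)

lemma measurable_response (alg : Algorithm X U) (θ : Fin d → ℝ) (t : ℕ) :
    Measurable (alg.response θ t) := by
  have h1 : Measurable fun x : X => (x : Fin d → ℝ) ⬝ᵥ θ := measurable_of_countable _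
  have h2 := (alg.measurable_arm t).comp
    (measurable_fst : Measurable (Prod.fst : (U × (Fin t → ℝ)) × (X → ℝ) → _))
  exact (h1.comp h2).add (measurable_apply_arm.comp (measurable_snd.prodMk h2))

/-- The history after one more round. -/
noncomputable def extendHistory (alg : Algorithm X U) (θ : Fin d → ℝ) (t : ℕ)
    (p : (U × (Fin t → ℝ)) × (X → ℝ)) : U × (Fin (t + 1) → ℝ) :=
  (p.1.1, Fin.snoc (α := fun _ => ℝ) p.1.2 (alg.response θ t p))

lemma measurable_extendHistory (alg : Algorithm X U) (θ : Fin d → ℝ) (t : ℕ) :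
    Measurable (alg.extendHistory θ t) :=
  (measurable_fst.comp measurable_fst).prodMk ((measurable_snoc t).comp
    ((measurable_snd.comp measurable_fst).prodMk (alg.measurable_response θ t)))

lemma history_succ (alg : Algorithm X U) (θ : Fin d → ℝ) (t : ℕ) (ω : U × (ℕ → X → ℝ)) :
    alg.history θ (t + 1) ω = alg.extendHistory θ t (alg.history θ t ω, ω.2 t) := rfl

lemma init_history (alg : Algorithm X U) (θ : Fin d → ℝ) (t : ℕ) (ω : U × (ℕ → X → ℝ)) :
    ((alg.history θ (t + 1) ω).1, Fin.init (alg.history θ (t + 1) ω).2) = alg.history θ t ω := by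
  rw [history_succ]; simp [extendHistory, history]

lemma measurable_history (alg : Algorithm X U) (θ : Fin d → ℝ) (t : ℕ) :
    Measurable (alg.history θ t) := by
  induction t with
  | zero =>
    exact measurable_fst.prodMk (measurable_pi_lambda _ fun i => i.elim0)
  | succ t ih =>
    exact (alg.measurable_extendHistory θ t).comp
      (ih.prodMk ((measurable_pi_apply t).comp measurable_snd))

lemma obs_congr (alg : Algorithm X U) (θ : Fin d → ℝ) (u : U) {η η' : ℕ → X → ℝ} (t : ℕ)
    (h : ∀ s < t, η s = η' s) : alg.obs θ (u, η) t = alg.obs θ (u, η') t := by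
  induction t with
  | zero => rfl
  | succ t ih =>
    have := ih fun s hs => h s (by omega)
    simp only [obs, this, h t (by omega)]

/-- The noise of round `t` is independent of the history before that round. -/
lemma map_history_noise (alg : Algorithm X U) (S : Matrix (Fin d) (Fin d) ℝ) (θ : Fin d → ℝ)
    (t : ℕ) :
    (alg.prob S).map (fun ω => (alg.history θ t ω, ω.2 t))
      = ((alg.prob S).map (alg.history θ t)).prod (roundNoise X S) := by
  have := alg.isProbabilityMeasure_seed
  let ν : Measure (ℕ → X → ℝ) := Measure.infinitePi fun _ => roundNoise X S
  have hprob : alg.prob S = alg.seed.prod ν := rfl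
  let R : (ℕ → X → ℝ) → (Finset.range t → X → ℝ) := fun η s => η s
  have hR : Measurable R := by fun_prop
  -- The history before round t factors through the seed and the noise of rounds below t; later
  -- noise is irrelevant and is filled with 0. Independence then reduces to that of the coordinates
  -- of a product measure.
  let G : U × (Finset.range t → X → ℝ) → U × (Fin t → ℝ) := fun p =>
    alg.history θ t (p.1, fun s => if h : s ∈ Finset.range t then p.2 ⟨s, h⟩ else 0)
  have hG : Measurable G := by
    refine (alg.measurable_history θ t).comp (measurable_fst.prodMk
      (measurable_pi_lambda _ fun s => ?_))
    by_cases h : s ∈ Finset.range t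
    · simpa [h, Function.comp_def] using
        (measurable_pi_apply (⟨s, h⟩ : Finset.range t)).comp measurable_snd
    · simp [h]
  have hGR : ∀ ω : U × (ℕ → X → ℝ), alg.history θ t ω = G (ω.1, R ω.2) := by
    intro ω
    refine Prod.ext rfl ?_
    refine alg.obs_congr θ ω.1 t fun s hs => ?_
    simp [R, hs]
  have hind : ν.map (fun η => (R η, η t)) = (ν.map R).prod (roundNoise X S) := by
    have h1 : iIndepFun (fun (i : ℕ) (η : ℕ → X → ℝ) => η i) ν :=
      iIndepFun_infinitePi (X := fun _ η => η) (fun _ => measurable_id)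
    have h2 := h1.indepFun_finset (Finset.range t) {t} (by simp) (fun i => measurable_pi_apply i)
    have h3 : IndepFun R (fun η : ℕ → X → ℝ => η t) ν :=
      h2.comp (φ := id) (ψ := fun η : (({t} : Finset ℕ) → X → ℝ) => η ⟨t, by simp⟩)
        measurable_id (by fun_prop)
    rw [(indepFun_iff_map_prod_eq_prod_map_map hR.aemeasurable
      (measurable_pi_apply t).aemeasurable).1 h3]
    congr 1
    exact Measure.infinitePi_map_eval _ t
  have hfst : (alg.prob S).map (fun ω => (ω.1, R ω.2)) = alg.seed.prod (ν.map R) := by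
    have := Measure.map_prod_map alg.seed ν measurable_id hR
    rw [Measure.map_id] at this
    rw [this]; rfl
  have hjoint : (alg.prob S).map (fun ω => (ω.1, (R ω.2, ω.2 t)))
      = alg.seed.prod ((ν.map R).prod (roundNoise X S)) := by
    have := Measure.map_prod_map alg.seed ν measurable_id (hR.prodMk (measurable_pi_apply t))
    rw [Measure.map_id, hind] at this
    rw [this]; rfl
  have : IsProbabilityMeasure (ν.map R) := Measure.isProbabilityMeasure_map hR.aemeasurable
  calc (alg.prob S).map (fun ω => (alg.history θ t ω, ω.2 t))
      = ((alg.prob S).map (fun ω => (ω.1, (R ω.2, ω.2 t)))).map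
          (Prod.map G id ∘ MeasurableEquiv.prodAssoc.symm) := by
        rw [Measure.map_map ((hG.prodMap measurable_id).comp (MeasurableEquiv.measurable _))
          (by fun_prop)]
        congr 1
        funext ω
        simp [Function.comp_def, hGR, MeasurableEquiv.prodAssoc]
    _ = (alg.seed.prod ((ν.map R).prod (roundNoise X S))).map
          (Prod.map G id ∘ MeasurableEquiv.prodAssoc.symm) := by rw [hjoint]
    _ = ((alg.seed.prod (ν.map R)).prod (roundNoise X S)).map (Prod.map G id) := by
        rw [← Measure.map_map (hG.prodMap measurable_id) (MeasurableEquiv.measurable _)]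
        congr 1
        exact ((measurePreserving_prodAssoc _ _ _).symm _).map_eq
    _ = ((alg.seed.prod (ν.map R)).map G).prod (roundNoise X S) := by
        have := Measure.map_prod_map (alg.seed.prod (ν.map R)) (roundNoise X S) hG measurable_id
        rw [Measure.map_id] at this
        exact this.symm
    _ = _ := by
        rw [← hfst, Measure.map_map hG (by fun_prop)]
        congr 2
        funext ω
        exact (hGR ω).symm

/-- Tonelli for the product law of history and fresh noise: it lets one round be integrated out with
the past frozen. -/
lemma lintegral_history_noise (alg : Algorithm X U) (S : Matrix (Fin d) (Fin d) ℝ)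
    (θ : Fin d → ℝ) (t : ℕ) {g : (U × (Fin t → ℝ)) × (X → ℝ) → ℝ≥0∞} (hg : Measurable g) :
    ∫⁻ ω, g (alg.history θ t ω, ω.2 t) ∂(alg.prob S)
      = ∫⁻ ω, ∫⁻ η, g (alg.history θ t ω, η) ∂(roundNoise X S) ∂(alg.prob S) := by
  have hm := (alg.measurable_history θ t).prodMk
    ((measurable_pi_apply t).comp (measurable_snd (α := U) (β := ℕ → X → ℝ)))
  have h1 := lintegral_map (μ := alg.prob S) hg hm
  have h2 : (alg.prob S).map (fun ω => (alg.history θ t ω, ((fun η : ℕ → X → ℝ => η t) ∘ Prod.snd) ω))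
    = _ := alg.map_history_noise S θ t
  rw [h2, lintegral_prod _ hg.aemeasurable,
    lintegral_map hg.lintegral_prod_right' (alg.measurable_history θ t)] at h1
  exact h1.symm

/-! ### Change of measure at a fixed time -/

/-- The log-likelihood ratio of the first `t` observations, under `θ` versus `θ'`. -/
noncomputable def llr (alg : Algorithm X U) (S : Matrix (Fin d) (Fin d) ℝ) (θ θ' : Fin d → ℝ) :
    (t : ℕ) → U × (Fin t → ℝ) → ℝ
  | 0, _ => 0
  | t + 1, p => llr alg S θ θ' t (p.1, Fin.init p.2) +
      armLLR S θ θ' (alg.arm t (p.1, Fin.init p.2) : X) (p.2 (Fin.last t))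

lemma measurable_armLLR (S : Matrix (Fin d) (Fin d) ℝ) (θ θ' : Fin d → ℝ) :
    Measurable fun q : ℝ × X => armLLR S θ θ' q.2 q.1 := by
  have h (x : X) : Measurable (armLLR S θ θ' x) := measurable_gaussianLLR _ _ _
  exact measurable_from_prod_countable_left (f := fun q : ℝ × X => armLLR S θ θ' q.2 q.1) h

lemma measurable_llr (alg : Algorithm X U) (S : Matrix (Fin d) (Fin d) ℝ) (θ θ' : Fin d → ℝ)
    (t : ℕ) : Measurable (alg.llr S θ θ' t) := by
  induction t with
  | zero => exact measurable_const
  | succ t ih =>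
    have hy : Measurable fun p : U × (Fin (t+1) → ℝ) => p.2 (Fin.last t) := by fun_prop
    exact (ih.comp (measurable_init t)).add ((measurable_armLLR S θ θ').comp
      (hy.prodMk ((alg.measurable_arm t).comp (measurable_init t))))

/-- Change of measure from `θ'` to `θ`. -/
lemma lintegral_history_change (alg : Algorithm X U) (S : Matrix (Fin d) (Fin d) ℝ)
    (hσ : ∀ x ∈ X, 0 < noiseVar S x) (θ θ' : Fin d → ℝ) (t : ℕ)
    {g : U × (Fin t → ℝ) → ℝ≥0∞} (hg : Measurable g) :
    ∫⁻ ω, g (alg.history θ' t ω) ∂(alg.prob S)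
      = ∫⁻ ω, g (alg.history θ t ω)
          * ENNReal.ofReal (Real.exp (-alg.llr S θ θ' t (alg.history θ t ω))) ∂(alg.prob S) := by
  induction t with
  | zero =>
    refine lintegral_congr fun ω => ?_
    simp [llr, history, obs]
  | succ t ih =>
    have hL : Measurable fun p => ENNReal.ofReal (Real.exp (-alg.llr S θ θ' (t+1) p)) :=
      (Real.measurable_exp.comp (alg.measurable_llr S θ θ' (t+1)).neg).ennreal_ofReal
    have hg' := hg.comp (alg.measurable_extendHistory θ' t)
    have e1 := alg.lintegral_history_noise S θ' t hg'
    have e2 := alg.lintegral_history_noise S θ t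
      ((hg.mul hL).comp (alg.measurable_extendHistory θ t))
    simp only [history_succ]
    simp only [Function.comp_def, Pi.mul_apply] at e1 e2
    -- The induction hypothesis is applied to `g` with the last round integrated out. What remains
    -- is a Gaussian change of mean for a fixed past, in which the arm and the earlier likelihood
    -- factor are constants.
    rw [e1, e2, ih (g := fun p => ∫⁻ η, g (alg.extendHistory θ' t (p, η)) ∂(roundNoise X S))
      hg'.lintegral_prod_right']
    refine lintegral_congr fun ω => ?_
    generalize alg.history θ t ω = p
    rw [← lintegral_mul_const _ (by exact hg'.comp measurable_prodMk_left)]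
    have hgs : Measurable fun y : ℝ => g (p.1, Fin.snoc (α := fun _ => ℝ) p.2 y) :=
      hg.comp (measurable_const.prodMk ((measurable_snoc t).comp
        (measurable_const.prodMk measurable_id)))
    have hv := hσ _ (alg.arm t p).2
    set L0 := ENNReal.ofReal (Real.exp (-alg.llr S θ θ' t p)) with hL0def
    have f1 := lintegral_roundNoise_eval S (alg.arm t p) (hgs.mul_const L0)
      ((alg.arm t p : X) ⬝ᵥ θ')
    have hgl : Measurable fun y => ENNReal.ofReal (Real.exp (-gaussianLLR
        ((alg.arm t p : X) ⬝ᵥ θ) ((alg.arm t p : X) ⬝ᵥ θ') (noiseVar S (alg.arm t p)) y)) :=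
      (Real.measurable_exp.comp (measurable_gaussianLLR _ _ _).neg).ennreal_ofReal
    have f2 := lintegral_roundNoise_eval S (alg.arm t p) ((hgs.mul_const L0).mul hgl)
      ((alg.arm t p : X) ⬝ᵥ θ)
    rw [lintegral_gaussianReal_change hv ((alg.arm t p : X) ⬝ᵥ θ) ((alg.arm t p : X) ⬝ᵥ θ')
      (hgs.mul_const L0)] at f1
    simp only [Pi.mul_apply] at f2
    refine f1.trans (f2.symm.trans (lintegral_congr fun η => ?_))
    simp only [extendHistory, response, llr, armLLR, Fin.init_snoc, Fin.snoc_last, Prod.mk.eta]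
    rw [neg_add, Real.exp_add, ENNReal.ofReal_mul (Real.exp_nonneg _), mul_assoc, hL0def]

end Algorithm
-- Pathwise bookkeeping for a stopped sum
section Stopping

variable {α : Type*} {o : ℕ → Option α} {P : ℕ → Prop}

lemma eq_none_of_pending (hs : ∀ t, P (t + 1) ↔ P t ∧ o t = none) {s t : ℕ} (hst : s < t)
    (h : P t) : o s = none := by
  induction t with
  | zero => omega
  | succ t ih =>
    rcases Nat.lt_succ_iff_lt_or_eq.1 hst with h1 | rfl
    · exact ih h1 ((hs t).1 h).1
    · exact ((hs s).1 h).2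

open Classical in
-- While the process is pending the sum telescopes to -L n and only the last term on the right is
-- nonzero; at the stopping time that term becomes a summand, and both sides are frozen afterwards.
-- Each term on the right depends on one fixed time, so that the fixed-time change of measure
-- applies to it.
lemma exp_sum_of_pending (h0 : P 0) (hs : ∀ t, P (t + 1) ↔ P t ∧ o t = none) {L l : ℕ → ℝ}
    (hL0 : L 0 = 0) (hL : ∀ t, L (t + 1) = L t + l t) (a : α) (c : ℝ) (n : ℕ) :
    Real.exp (∑ t ∈ Finset.range n,
        ((if P t ∧ o t = some a then c else 0) - if P (t + 1) then l t else 0))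
      = ∑ t ∈ Finset.range n, (if P t ∧ o t ≠ none then if o t = some a then Real.exp c else 1
            else 0) * Real.exp (-L t)
        + (if P n then 1 else 0) * Real.exp (-L n) := by
  have key : ∀ n, P n → ∑ t ∈ Finset.range n,
      ((if P t ∧ o t = some a then c else 0) - if P (t + 1) then l t else 0) = -L n := by
    intro n
    induction n with
    | zero => intro; simp [hL0]
    | succ n ih =>
      intro h
      obtain ⟨h1, h2⟩ := (hs n).1 h
      rw [Finset.sum_range_succ, ih h1, hL]
      simp [h, h2]
      ring
  induction n with
  | zero => simp [h0, hL0]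
  | succ n ih =>
    rw [Finset.sum_range_succ, Real.exp_add, Finset.sum_range_succ]
    by_cases hn : P n
    · have hk := key n hn
      have hz := ih
      rw [hk, if_pos hn, one_mul] at hz
      -- Comparing `ih` with the telescoped value shows that no stopping term has contributed yet.
      have hz' := eq_sub_of_add_eq hz.symm
      rw [sub_self] at hz'
      rw [hk, hz', zero_add]
      cases ho : o n with
      | none => simp [hs, hn, ho, hL, Real.exp_add, mul_comm]
      | some b =>
        by_cases hb : b = a <;> simp [hs, hn, ho, hb, mul_comm]
    · rw [ih]
      simp [hs, hn]

open Classical in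
lemma sum_ite_stopped_le (hs : ∀ t, P (t + 1) ↔ P t ∧ o t = none) (a : α) {c : ℝ} (hc : 0 ≤ c)
    (n : ℕ) :
    ∑ t ∈ Finset.range n, (if P t ∧ o t = some a then c else 0)
      ≤ if ∃ t, P t ∧ o t = some a then c else 0 := by
  split_ifs with h
  · obtain ⟨t, ht, hta⟩ := h
    have huniq : ∀ s, P s ∧ o s = some a → s = t := by
      rintro s ⟨hs1, hs2⟩
      rcases lt_trichotomy s t with hlt | heq | hlt
      · simp [eq_none_of_pending hs hlt ht] at hs2
      · exact heq
      · simp [eq_none_of_pending hs hlt hs1] at hta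
    calc ∑ s ∈ Finset.range n, (if P s ∧ o s = some a then c else 0)
        ≤ ∑ s ∈ Finset.range n, (if s = t then c else 0) := by
          refine Finset.sum_le_sum fun s _ => ?_
          split_ifs with h1 h2 h2
          · rfl
          · exact absurd (huniq s h1) h2
          · exact hc
          · rfl
      _ ≤ c := by
          rw [Finset.sum_ite_eq']
          split_ifs <;> simp [hc]
  · refine (Finset.sum_eq_zero fun t _ => ?_).le
    exact if_neg fun ht => h ⟨t, ht⟩

end Stopping

/-! ### Stopping events and expected numbers of pulls -/

namespace Algorithm

variable {d : ℕ} {X : Finset (Fin d → ℝ)} {U : Type*} [MeasurableSpace U]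

/-- The algorithm has not stopped before `t` observations. -/
def Pending (alg : Algorithm X U) : (t : ℕ) → U × (Fin t → ℝ) → Prop
  | 0, _ => True
  | t + 1, p => Pending alg t (p.1, Fin.init p.2) ∧ alg.rule t (p.1, Fin.init p.2) = none

lemma measurableSet_pending (alg : Algorithm X U) (t : ℕ) :
    MeasurableSet {p | alg.Pending t p} := by
  induction t with
  | zero => simp [Pending]
  | succ t ih =>
    exact ((ih.inter (alg.measurableSet_rule t none)).preimage (measurable_init t))

lemma pending_succ_history (alg : Algorithm X U) (θ : Fin d → ℝ) (ω : U × (ℕ → X → ℝ)) (t : ℕ) :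
    alg.Pending (t + 1) (alg.history θ (t + 1) ω)
      ↔ alg.Pending t (alg.history θ t ω) ∧ alg.outcome θ ω t = none := by
  rw [Pending, alg.init_history θ t ω]; rfl

lemma llr_succ_history (alg : Algorithm X U) (S : Matrix (Fin d) (Fin d) ℝ) (θ θ' : Fin d → ℝ)
    (ω : U × (ℕ → X → ℝ)) (t : ℕ) :
    alg.llr S θ θ' (t + 1) (alg.history θ (t + 1) ω)
      = alg.llr S θ θ' t (alg.history θ t ω)
        + armLLR S θ θ' (alg.arm t (alg.history θ t ω) : X)
            (alg.response θ t (alg.history θ t ω, ω.2 t)) := by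
  rw [llr, alg.init_history θ t ω]
  congr 2
  rw [history_succ]; simp [extendHistory]

lemma le_tau_of_pending (alg : Algorithm X U) (θ : Fin d → ℝ) (ω : U × (ℕ → X → ℝ)) {t : ℕ}
    (h : alg.Pending t (alg.history θ t ω)) : (t : ℕ∞) ≤ alg.tau θ ω := by
  refine le_iInf₂ fun s hs => ?_
  by_contra hlt
  have hst : s < t := by exact_mod_cast not_le.1 hlt
  exact hs (eq_none_of_pending (P := fun t => alg.Pending t (alg.history θ t ω))
    (alg.pending_succ_history θ ω) hst h)

lemma pending_of_forall_lt (alg : Algorithm X U) (θ : Fin d → ℝ) (ω : U × (ℕ → X → ℝ)) {t : ℕ}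
    (h : ∀ s < t, alg.outcome θ ω s = none) : alg.Pending t (alg.history θ t ω) := by
  induction t with
  | zero => trivial
  | succ t ih =>
    exact (alg.pending_succ_history θ ω t).2 ⟨ih fun s hs => h s (by omega), h t (by omega)⟩

/-- Replaces the infimum defining τ by conditions on the history at one fixed time, which are
measurable and compatible with the change of measure. -/
lemma returns_iff (alg : Algorithm X U) (θ : Fin d → ℝ) (H : Set (Fin d → ℝ))
    (ω : U × (ℕ → X → ℝ)) :
    alg.Returns θ H ω
      ↔ ∃ t, alg.Pending t (alg.history θ t ω) ∧ alg.outcome θ ω t = some H := by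
  refine exists_congr fun t => and_congr_left fun ho => ⟨fun ht => ?_, fun hp => ?_⟩
  · refine alg.pending_of_forall_lt θ ω fun s hs => ?_
    by_contra hne
    have : alg.tau θ ω ≤ s := iInf₂_le s hne
    rw [ht] at this
    exact absurd (by exact_mod_cast this : t ≤ s) (by omega)
  · exact le_antisymm (iInf₂_le t (by simp [ho])) (alg.le_tau_of_pending θ ω hp)

lemma measurableSet_outcome (alg : Algorithm X U) (θ : Fin d → ℝ) (t : ℕ)
    (o : Option (Set (Fin d → ℝ))) : MeasurableSet {ω | alg.outcome θ ω t = o} :=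
  (alg.measurableSet_rule t o).preimage (alg.measurable_history θ t)

/-- The event of stopping after exactly `t` observations and returning `H`. -/
def returnsAt (alg : Algorithm X U) (θ : Fin d → ℝ) (H : Set (Fin d → ℝ)) (t : ℕ) :
    Set (U × (ℕ → X → ℝ)) :=
  {ω | alg.Pending t (alg.history θ t ω) ∧ alg.outcome θ ω t = some H}

lemma measurableSet_returnsAt (alg : Algorithm X U) (θ : Fin d → ℝ) (H : Set (Fin d → ℝ))
    (t : ℕ) : MeasurableSet (alg.returnsAt θ H t) :=
  ((alg.measurableSet_pending t).preimage (alg.measurable_history θ t)).inter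
    (alg.measurableSet_outcome θ t _)

lemma setOf_returns_eq (alg : Algorithm X U) (θ : Fin d → ℝ) (H : Set (Fin d → ℝ)) :
    {ω | alg.Returns θ H ω} = ⋃ t, alg.returnsAt θ H t := by
  ext ω
  simp [returns_iff, returnsAt]

lemma measurableSet_returns (alg : Algorithm X U) (θ : Fin d → ℝ) (H : Set (Fin d → ℝ)) :
    MeasurableSet {ω | alg.Returns θ H ω} := by
  rw [setOf_returns_eq]
  exact MeasurableSet.iUnion fun t => alg.measurableSet_returnsAt θ H t

lemma disjoint_returns (alg : Algorithm X U) (θ : Fin d → ℝ) {H H' : Set (Fin d → ℝ)}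
    (h : H ≠ H') : Disjoint {ω | alg.Returns θ H ω} {ω | alg.Returns θ H' ω} := by
  rw [Set.disjoint_left]
  rintro ω ⟨t, ht, ho⟩ ⟨t', ht', ho'⟩
  have : t = t' := by exact_mod_cast ht.symm.trans ht'
  subst this
  exact h (Option.some.inj (ho.symm.trans ho'))

lemma hasSum_returnsAt (alg : Algorithm X U) (S : Matrix (Fin d) (Fin d) ℝ) (θ : Fin d → ℝ)
    (H : Set (Fin d → ℝ)) :
    HasSum (fun t => (alg.prob S).real (alg.returnsAt θ H t))
      ((alg.prob S).real {ω | alg.Returns θ H ω}) := by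
  have hd : Pairwise (Function.onFun Disjoint (alg.returnsAt θ H)) := by
    have key : ∀ s t, s < t → Disjoint (alg.returnsAt θ H s) (alg.returnsAt θ H t) := by
      intro s t hst
      rw [Set.disjoint_left]
      rintro ω ⟨-, h2⟩ ⟨h3, -⟩
      have := eq_none_of_pending (P := fun t => alg.Pending t (alg.history θ t ω))
        (alg.pending_succ_history θ ω) hst h3
      simp [this] at h2
    intro s t hst
    rcases lt_or_gt_of_ne hst with h | h
    · exact key s t h
    · exact (key t s h).symm
  have h := measure_iUnion (μ := alg.prob S) hd (alg.measurableSet_returnsAt θ H)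
  rw [← setOf_returns_eq] at h
  have hne : ∑' t, (alg.prob S) (alg.returnsAt θ H t) ≠ ∞ := h ▸ measure_ne_top _ _
  rw [Measure.real, h, ENNReal.tsum_toReal_eq fun t => measure_ne_top _ _]
  exact ENNReal.hasSum_toReal hne

/-- The event of drawing an observation from the arm `x` in round `t`. -/
def pulls (alg : Algorithm X U) (θ : Fin d → ℝ) (x : X) (t : ℕ) : Set (U × (ℕ → X → ℝ)) :=
  {ω | alg.Pending (t + 1) (alg.history θ (t + 1) ω) ∧ alg.arm t (alg.history θ t ω) = x}

lemma measurableSet_pulls (alg : Algorithm X U) (θ : Fin d → ℝ) (x : X) (t : ℕ) :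
    MeasurableSet (alg.pulls θ x t) :=
  ((alg.measurableSet_pending (t + 1)).preimage (alg.measurable_history θ (t + 1))).inter
    ((measurableSet_singleton x).preimage ((alg.measurable_arm t).comp
      (alg.measurable_history θ t)))

/-- The expected number of observations drawn from the arm `x`. -/
noncomputable def expectedPulls (alg : Algorithm X U) (S : Matrix (Fin d) (Fin d) ℝ)
    (θ : Fin d → ℝ) (x : X) : ℝ≥0∞ :=
  ∑' t, alg.prob S (alg.pulls θ x t)

open Classical in
lemma tsum_indicator_pending_le (alg : Algorithm X U) (θ : Fin d → ℝ) (ω : U × (ℕ → X → ℝ)) :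
    ∑' t : ℕ, (if alg.Pending (t + 1) (alg.history θ (t + 1) ω) then (1 : ℝ≥0∞) else 0)
      ≤ (alg.tau θ ω : ℝ≥0∞) := by
  cases htau : alg.tau θ ω with
  | top => simp
  | coe n =>
    rw [tsum_eq_sum (s := Finset.range n)]
    · calc _ ≤ ∑ t ∈ Finset.range n, (1 : ℝ≥0∞) := by
            refine Finset.sum_le_sum fun t _ => ?_
            split_ifs <;> simp
        _ = _ := by simp
    · intro t ht
      refine if_neg fun hp => ?_
      have := alg.le_tau_of_pending θ ω hp
      rw [htau] at this
      have : t + 1 ≤ n := by exact_mod_cast this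
      simp at ht
      omega

/-- Exactly one arm is pulled in each round that takes place, and round t takes place only if t + 1
≤ τ. -/
lemma sum_expectedPulls_le (alg : Algorithm X U) (S : Matrix (Fin d) (Fin d) ℝ) (θ : Fin d → ℝ) :
    ∑ x, alg.expectedPulls S θ x ≤ alg.expectedTau S θ := by
  classical
  have hm : ∀ t, MeasurableSet {ω | alg.Pending (t + 1) (alg.history θ (t + 1) ω)} := fun t =>
    (alg.measurableSet_pending (t + 1)).preimage (alg.measurable_history θ (t + 1))
  calc ∑ x, alg.expectedPulls S θ x
      = ∑' t, ∑ x, alg.prob S (alg.pulls θ x t) := by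
        simp only [expectedPulls]
        rw [Summable.tsum_finsetSum fun _ _ => ENNReal.summable]
    _ = ∑' t, alg.prob S {ω | alg.Pending (t + 1) (alg.history θ (t + 1) ω)} := by
        refine tsum_congr fun t => ?_
        rw [← measure_biUnion_finset]
        · congr 1
          ext ω
          simp [pulls]
        · intro x _ y _ hxy
          refine Set.disjoint_left.2 fun ω hx hy => hxy (hx.2.symm.trans hy.2)
        · exact fun x _ => alg.measurableSet_pulls θ x t
    _ = ∫⁻ ω, ∑' t : ℕ, (if alg.Pending (t + 1) (alg.history θ (t + 1) ω) then (1 : ℝ≥0∞) else 0)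
          ∂(alg.prob S) := by
        rw [lintegral_tsum fun t => (Measurable.ite (hm t) measurable_const
          measurable_const).aemeasurable]
        refine tsum_congr fun t => ?_
        rw [← lintegral_indicator_one (hm t)]
        refine lintegral_congr fun ω => ?_
        simp [Set.indicator_apply]
    _ ≤ alg.expectedTau S θ := lintegral_mono fun ω => alg.tsum_indicator_pending_le θ ω

/-! ### The exponential moment of the stopped likelihood ratio -/

open Classical in
/-- The factor `exp (c · 1{H returned})` on stopping after `t` observations. -/
noncomputable def stopWeight (alg : Algorithm X U) (H : Set (Fin d → ℝ)) (c : ℝ) (t : ℕ)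
    (p : U × (Fin t → ℝ)) : ℝ :=
  if alg.Pending t p ∧ alg.rule t p ≠ none then if alg.rule t p = some H then Real.exp c else 1
  else 0

lemma stopWeight_nonneg (alg : Algorithm X U) (H : Set (Fin d → ℝ)) (c : ℝ) (t : ℕ)
    (p : U × (Fin t → ℝ)) : 0 ≤ alg.stopWeight H c t p := by
  unfold stopWeight; split_ifs <;> positivity

lemma measurable_stopWeight (alg : Algorithm X U) (H : Set (Fin d → ℝ)) (c : ℝ) (t : ℕ) :
    Measurable (alg.stopWeight H c t) :=
  Measurable.ite ((alg.measurableSet_pending t).inter (alg.measurableSet_rule t none).compl)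
    (Measurable.ite (alg.measurableSet_rule t _) measurable_const measurable_const)
    measurable_const

open Classical in
/-- The indicator of not having stopped before `t` observations. -/
noncomputable def pendingWeight (alg : Algorithm X U) (t : ℕ) (p : U × (Fin t → ℝ)) : ℝ :=
  if alg.Pending t p then 1 else 0

lemma pendingWeight_nonneg (alg : Algorithm X U) (t : ℕ) (p : U × (Fin t → ℝ)) :
    0 ≤ alg.pendingWeight t p := by
  unfold pendingWeight; split_ifs <;> positivity

lemma measurable_pendingWeight (alg : Algorithm X U) (t : ℕ) :
    Measurable (alg.pendingWeight t) :=
  Measurable.ite (alg.measurableSet_pending t) measurable_const measurable_const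

open Classical in
/-- `c` times the indicator of returning `H` after `t` observations. -/
noncomputable def reward (alg : Algorithm X U) (θ : Fin d → ℝ) (H : Set (Fin d → ℝ)) (c : ℝ)
    (t : ℕ) (ω : U × (ℕ → X → ℝ)) : ℝ :=
  if alg.Pending t (alg.history θ t ω) ∧ alg.outcome θ ω t = some H then c else 0

open Classical in
/-- The contribution of round `t` to the log-likelihood ratio stopped at `τ`. -/
noncomputable def stoppedIncrement (alg : Algorithm X U) (S : Matrix (Fin d) (Fin d) ℝ)
    (θ θ' : Fin d → ℝ) (t : ℕ) (ω : U × (ℕ → X → ℝ)) : ℝ :=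
  if alg.Pending (t + 1) (alg.history θ (t + 1) ω) then
    armLLR S θ θ' (alg.arm t (alg.history θ t ω) : X)
      (alg.response θ t (alg.history θ t ω, ω.2 t)) else 0

lemma reward_eq_indicator (alg : Algorithm X U) (θ : Fin d → ℝ) (H : Set (Fin d → ℝ)) (c : ℝ)
    (t : ℕ) : alg.reward θ H c t = (alg.returnsAt θ H t).indicator fun _ => c := by
  funext ω
  by_cases h : ω ∈ alg.returnsAt θ H t
  · rw [Set.indicator_of_mem h]; exact if_pos h
  · rw [Set.indicator_of_notMem h]; exact if_neg h

lemma exp_sum_reward_sub (alg : Algorithm X U) (S : Matrix (Fin d) (Fin d) ℝ) (θ θ' : Fin d → ℝ)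
    (H : Set (Fin d → ℝ)) (c : ℝ) (n : ℕ) (ω : U × (ℕ → X → ℝ)) :
    Real.exp (∑ t ∈ Finset.range n, (alg.reward θ H c t ω - alg.stoppedIncrement S θ θ' t ω))
      = ∑ t ∈ Finset.range n, alg.stopWeight H c t (alg.history θ t ω)
          * Real.exp (-alg.llr S θ θ' t (alg.history θ t ω))
        + alg.pendingWeight n (alg.history θ n ω)
          * Real.exp (-alg.llr S θ θ' n (alg.history θ n ω)) :=
  exp_sum_of_pending (P := fun t => alg.Pending t (alg.history θ t ω)) trivial
    (alg.pending_succ_history θ ω) rfl (alg.llr_succ_history S θ θ' ω) H c n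

lemma exp_sum_reward (alg : Algorithm X U) (θ : Fin d → ℝ)
    (H : Set (Fin d → ℝ)) (c : ℝ) (n : ℕ) (ω : U × (ℕ → X → ℝ)) :
    Real.exp (∑ t ∈ Finset.range n, alg.reward θ H c t ω)
      = ∑ t ∈ Finset.range n, alg.stopWeight H c t (alg.history θ t ω)
        + alg.pendingWeight n (alg.history θ n ω) := by
  have := exp_sum_of_pending (P := fun t => alg.Pending t (alg.history θ t ω)) trivial
    (alg.pending_succ_history θ ω) (L := fun _ => 0) (l := fun _ => 0) rfl (by simp) H c n
  simp only [ite_self, sub_zero, neg_zero, Real.exp_zero, mul_one] at this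
  exact this

/-- The stopped likelihood factor converts the expectation under `θ` into one under `θ'`: after the
pathwise splitting, every summand is a weight of a fixed-time history times its likelihood factor.
-/
lemma lintegral_exp_sum_reward_sub (alg : Algorithm X U) (S : Matrix (Fin d) (Fin d) ℝ)
    (hσ : ∀ x ∈ X, 0 < noiseVar S x) (θ θ' : Fin d → ℝ)
    (H : Set (Fin d → ℝ)) (c : ℝ) (n : ℕ) :
    ∫⁻ ω, ENNReal.ofReal (Real.exp (∑ t ∈ Finset.range n,
        (alg.reward θ H c t ω - alg.stoppedIncrement S θ θ' t ω))) ∂(alg.prob S)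
      = ∫⁻ ω, ENNReal.ofReal (Real.exp (∑ t ∈ Finset.range n, alg.reward θ' H c t ω))
          ∂(alg.prob S) := by
  have hL : ∀ t, Measurable fun p => ENNReal.ofReal (Real.exp (-alg.llr S θ θ' t p)) := fun t =>
    (Real.measurable_exp.comp (alg.measurable_llr S θ θ' t).neg).ennreal_ofReal
  have hs := fun t => (alg.measurable_stopWeight H c t).ennreal_ofReal
  have hp := fun t => (alg.measurable_pendingWeight t).ennreal_ofReal
  have e1 : ∀ ω, ENNReal.ofReal (Real.exp (∑ t ∈ Finset.range n,
        (alg.reward θ H c t ω - alg.stoppedIncrement S θ θ' t ω)))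
      = ∑ t ∈ Finset.range n, ENNReal.ofReal (alg.stopWeight H c t (alg.history θ t ω))
          * ENNReal.ofReal (Real.exp (-alg.llr S θ θ' t (alg.history θ t ω)))
        + ENNReal.ofReal (alg.pendingWeight n (alg.history θ n ω))
          * ENNReal.ofReal (Real.exp (-alg.llr S θ θ' n (alg.history θ n ω))) := by
    intro ω
    have h1 : ∀ t, 0 ≤ alg.stopWeight H c t (alg.history θ t ω)
          * Real.exp (-alg.llr S θ θ' t (alg.history θ t ω)) := fun t =>
      mul_nonneg (alg.stopWeight_nonneg _ _ _ _) (Real.exp_nonneg _)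
    rw [exp_sum_reward_sub, ENNReal.ofReal_add (Finset.sum_nonneg fun t _ => h1 t)
      (mul_nonneg (alg.pendingWeight_nonneg _ _) (Real.exp_nonneg _)),
      ENNReal.ofReal_sum_of_nonneg fun t _ => h1 t,
      ENNReal.ofReal_mul (alg.pendingWeight_nonneg _ _)]
    simp only [ENNReal.ofReal_mul (alg.stopWeight_nonneg _ _ _ _)]
  have e2 : ∀ ω, ENNReal.ofReal (Real.exp (∑ t ∈ Finset.range n, alg.reward θ' H c t ω))
      = ∑ t ∈ Finset.range n, ENNReal.ofReal (alg.stopWeight H c t (alg.history θ' t ω))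
        + ENNReal.ofReal (alg.pendingWeight n (alg.history θ' n ω)) := by
    intro ω
    rw [exp_sum_reward, ENNReal.ofReal_add (Finset.sum_nonneg fun t _ =>
      alg.stopWeight_nonneg _ _ _ _) (alg.pendingWeight_nonneg _ _),
      ENNReal.ofReal_sum_of_nonneg fun t _ => alg.stopWeight_nonneg _ _ _ _]
  have m1 : ∀ t, Measurable fun ω => ENNReal.ofReal (alg.stopWeight H c t (alg.history θ t ω))
      * ENNReal.ofReal (Real.exp (-alg.llr S θ θ' t (alg.history θ t ω))) := fun t =>
    ((hs t).mul (hL t)).comp (alg.measurable_history θ t)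
  have m2 : ∀ t, Measurable fun ω => ENNReal.ofReal (alg.pendingWeight t (alg.history θ t ω))
      * ENNReal.ofReal (Real.exp (-alg.llr S θ θ' t (alg.history θ t ω))) := fun t =>
    ((hp t).mul (hL t)).comp (alg.measurable_history θ t)
  have m3 : ∀ t, Measurable fun ω => ENNReal.ofReal (alg.stopWeight H c t (alg.history θ' t ω)) :=
    fun t => (hs t).comp (alg.measurable_history θ' t)
  have m4 : ∀ t, Measurable fun ω => ENNReal.ofReal (alg.pendingWeight t (alg.history θ' t ω)) :=
    fun t => (hp t).comp (alg.measurable_history θ' t)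
  simp only [e1, e2]
  rw [lintegral_add_right _ (m2 n), lintegral_add_right _ (m4 n),
    lintegral_finsetSum _ fun t _ => m1 t, lintegral_finsetSum _ fun t _ => m3 t]
  congr 1
  · exact Finset.sum_congr rfl fun t _ => (alg.lintegral_history_change S hσ θ θ' t (hs t)).symm
  · exact (alg.lintegral_history_change S hσ θ θ' n (hp n)).symm

/-- The rewards add up to at most c·1{H returned}, and exp(c·1_E) = 1 + (exp c - 1)·1_E. -/
lemma lintegral_exp_sum_reward_le (alg : Algorithm X U) (S : Matrix (Fin d) (Fin d) ℝ)
    (θ : Fin d → ℝ) (H : Set (Fin d → ℝ)) {c : ℝ} (hc : 0 ≤ c) (n : ℕ) :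
    ∫⁻ ω, ENNReal.ofReal (Real.exp (∑ t ∈ Finset.range n, alg.reward θ H c t ω)) ∂(alg.prob S)
      ≤ ENNReal.ofReal (1 + (Real.exp c - 1) * (alg.prob S).real {ω | alg.Returns θ H ω}) := by
  have hc1 : 0 ≤ Real.exp c - 1 := by linarith [Real.add_one_le_exp c]
  have hE := alg.measurableSet_returns θ H
  calc _ ≤ ∫⁻ ω, (1 + {ω | alg.Returns θ H ω}.indicator
        (fun _ => ENNReal.ofReal (Real.exp c - 1)) ω) ∂(alg.prob S) := by
        refine lintegral_mono fun ω => ?_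
        have h := sum_ite_stopped_le (P := fun t => alg.Pending t (alg.history θ t ω))
          (alg.pending_succ_history θ ω) H hc n
        rw [← alg.returns_iff θ H ω] at h
        have h' := Real.exp_le_exp.2 h
        by_cases hr : alg.Returns θ H ω
        · rw [if_pos hr] at h'
          rw [Set.indicator_of_mem (by exact hr), ← ENNReal.ofReal_one,
            ← ENNReal.ofReal_add zero_le_one hc1]
          exact ENNReal.ofReal_le_ofReal (h'.trans (by linarith))
        · rw [if_neg hr, Real.exp_zero] at h'
          rw [Set.indicator_of_notMem (by exact hr), add_zero, ← ENNReal.ofReal_one]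
          exact ENNReal.ofReal_le_ofReal h'
    _ = _ := by
        rw [lintegral_add_left measurable_const, lintegral_indicator_const hE]
        rw [ENNReal.ofReal_add zero_le_one (mul_nonneg hc1 measureReal_nonneg),
          ENNReal.ofReal_mul hc1, ofReal_measureReal]
        simp

/-! ### The mean of the stopped log-likelihood ratio -/

lemma map_noise (alg : Algorithm X U) (S : Matrix (Fin d) (Fin d) ℝ) (t : ℕ) :
    (alg.prob S).map (fun ω => ω.2 t) = roundNoise X S := by
  have := alg.isProbabilityMeasure_seed
  have h1 : (alg.prob S).map Prod.snd = Measure.infinitePi fun _ => roundNoise X S := by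
    unfold prob
    rw [Measure.map_snd_prod]
    simp [roundNoise]
  have h2 := Measure.map_map (μ := alg.prob S) (measurable_pi_apply (X := fun _ => X → ℝ) t)
    measurable_snd
  rw [h1] at h2
  exact h2.symm.trans (Measure.infinitePi_map_eval _ t)

lemma map_noise_eval (alg : Algorithm X U) (S : Matrix (Fin d) (Fin d) ℝ) (t : ℕ) (x : X) :
    (alg.prob S).map (fun ω => ω.2 t x) = gaussianReal 0 (noiseVar S x).toNNReal := by
  have h : (roundNoise X S).map (fun η => η x) = gaussianReal 0 (noiseVar S x).toNNReal :=
    (measurePreserving_eval (fun x : X => gaussianReal 0 (noiseVar S x).toNNReal) x).map_eq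
  rw [← h, ← alg.map_noise S t, Measure.map_map (by fun_prop) (by fun_prop)]
  rfl

lemma integrable_noise (alg : Algorithm X U) (S : Matrix (Fin d) (Fin d) ℝ) (t : ℕ) (x : X) :
    Integrable (fun ω => ω.2 t x) (alg.prob S) := by
  have h : Integrable id ((alg.prob S).map (fun ω => ω.2 t x)) := by
    rw [map_noise_eval]
    exact (memLp_id_gaussianReal 1).integrable (by simp)
  exact h.comp_measurable (by fun_prop)

lemma integral_noise (alg : Algorithm X U) (S : Matrix (Fin d) (Fin d) ℝ) (t : ℕ) (x : X) :
    ∫ ω, ω.2 t x ∂(alg.prob S) = 0 := by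
  have h := integral_map (μ := alg.prob S) (φ := fun ω => ω.2 t x) (f := fun y : ℝ => y)
    (by fun_prop) (by fun_prop)
  rw [← h, map_noise_eval, integral_id_gaussianReal]

lemma indepFun_history_noise (alg : Algorithm X U) (S : Matrix (Fin d) (Fin d) ℝ)
    (θ : Fin d → ℝ) (t : ℕ) :
    IndepFun (alg.history θ t) (fun ω => ω.2 t) (alg.prob S) := by
  rw [indepFun_iff_map_prod_eq_prod_map_map (alg.measurable_history θ t).aemeasurable
    (by fun_prop), map_noise]
  exact alg.map_history_noise S θ t

/-- Being about to draw an observation from the arm `x`, in terms of the history. -/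
def aboutToPull (alg : Algorithm X U) (x : X) (t : ℕ) : Set (U × (Fin t → ℝ)) :=
  {p | (alg.Pending t p ∧ alg.rule t p = none) ∧ alg.arm t p = x}

lemma measurableSet_aboutToPull (alg : Algorithm X U) (x : X) (t : ℕ) :
    MeasurableSet (alg.aboutToPull x t) :=
  ((alg.measurableSet_pending t).inter (alg.measurableSet_rule t none)).inter
    (alg.measurable_arm t (measurableSet_singleton x))

lemma preimage_aboutToPull (alg : Algorithm X U) (θ : Fin d → ℝ) (x : X) (t : ℕ) :
    alg.history θ t ⁻¹' alg.aboutToPull x t = alg.pulls θ x t := by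
  ext ω
  simp only [pulls, aboutToPull, Set.mem_preimage, Set.mem_ofPred_eq, pending_succ_history]
  rfl

/-- The decision to pull x in round t is a function of the history, hence independent of the centred
noise of that round. -/
lemma integral_pulls_noise (alg : Algorithm X U) (S : Matrix (Fin d) (Fin d) ℝ)
    (θ : Fin d → ℝ) (x : X) (t : ℕ) :
    ∫ ω, (alg.pulls θ x t).indicator (fun ω => ω.2 t x) ω ∂(alg.prob S) = 0 := by
  have hi : IndepFun (fun ω => (alg.aboutToPull x t).indicator (fun _ => (1:ℝ)) (alg.history θ t ω))
      (fun ω => ω.2 t x) (alg.prob S) :=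
    (alg.indepFun_history_noise S θ t).comp
      (measurable_const.indicator (alg.measurableSet_aboutToPull x t)) (measurable_pi_apply x)
  have h := hi.integral_fun_mul_eq_mul_integral
    ((measurable_const.indicator (alg.measurableSet_aboutToPull x t)).comp
      (alg.measurable_history θ t)).aestronglyMeasurable
    (alg.integrable_noise S t x).aestronglyMeasurable
  rw [integral_noise, mul_zero] at h
  rw [← h]
  refine integral_congr_ae (Filter.Eventually.of_forall fun ω => ?_)
  rw [← preimage_aboutToPull]
  by_cases hω : alg.history θ t ω ∈ alg.aboutToPull x t <;> simp [hω]

/-- Substituting y = xᵀθ + η in the log-likelihood ratio leaves a term linear in η and the Gaussian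
relative entropy. -/
lemma stoppedIncrement_eq (alg : Algorithm X U) (S : Matrix (Fin d) (Fin d) ℝ)
    (θ θ' : Fin d → ℝ) (t : ℕ) (ω : U × (ℕ → X → ℝ)) :
    alg.stoppedIncrement S θ θ' t ω = ∑ x : X,
      ((x ⬝ᵥ (θ - θ')) / noiseVar S x * (alg.pulls θ x t).indicator (fun ω => ω.2 t x) ω
        + (alg.pulls θ x t).indicator (fun _ => (x ⬝ᵥ (θ - θ')) ^ 2 / (2 * noiseVar S x)) ω) := by
  classical
  unfold stoppedIncrement
  split_ifs with h
  · rw [Finset.sum_eq_single (alg.arm t (alg.history θ t ω))]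
    · have hmem : ω ∈ alg.pulls θ (alg.arm t (alg.history θ t ω)) t := ⟨h, rfl⟩
      rw [Set.indicator_of_mem hmem, Set.indicator_of_mem hmem]
      simp only [armLLR, gaussianLLR, response, dotProduct_sub]
      -- For zero variance both sides vanish because division by 0 gives 0, so positivity is not
      -- needed.
      by_cases h0 : noiseVar S (alg.arm t (alg.history θ t ω) : X) = 0
      · simp [h0]
      · field_simp
        ring
    · intro x _ hx
      have hmem : ω ∉ alg.pulls θ x t := fun hm => hx hm.2.symm
      simp [Set.indicator_of_notMem hmem]
    · simp
  · refine (Finset.sum_eq_zero fun x _ => ?_).symm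
    have hmem : ω ∉ alg.pulls θ x t := fun hm => h hm.1
    simp [Set.indicator_of_notMem hmem]

lemma integrable_pulls_noise (alg : Algorithm X U) (S : Matrix (Fin d) (Fin d) ℝ)
    (θ : Fin d → ℝ) (x : X) (t : ℕ) :
    Integrable ((alg.pulls θ x t).indicator (fun ω => ω.2 t x)) (alg.prob S) :=
  (alg.integrable_noise S t x).indicator (alg.measurableSet_pulls θ x t)

lemma integrable_stoppedIncrement (alg : Algorithm X U) (S : Matrix (Fin d) (Fin d) ℝ)
    (θ θ' : Fin d → ℝ) (t : ℕ) : Integrable (alg.stoppedIncrement S θ θ' t) (alg.prob S) := by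
  rw [funext (alg.stoppedIncrement_eq S θ θ' t)]
  exact integrable_finsetSum _ fun x _ => ((alg.integrable_pulls_noise S θ x t).const_mul _).add
    ((integrable_const _).indicator (alg.measurableSet_pulls θ x t))

lemma integral_stoppedIncrement (alg : Algorithm X U) (S : Matrix (Fin d) (Fin d) ℝ)
    (θ θ' : Fin d → ℝ) (t : ℕ) :
    ∫ ω, alg.stoppedIncrement S θ θ' t ω ∂(alg.prob S)
      = ∑ x : X, (alg.prob S).real (alg.pulls θ x t)
          * ((x ⬝ᵥ (θ - θ')) ^ 2 / (2 * noiseVar S x)) := by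
  have hc (x : X) (r : ℝ) : Integrable ((alg.pulls θ x t).indicator fun _ => r) (alg.prob S) :=
    (integrable_const _).indicator (alg.measurableSet_pulls θ x t)
  have hi (x : X) : Integrable (fun ω =>
      (x ⬝ᵥ (θ - θ')) / noiseVar S x * (alg.pulls θ x t).indicator (fun ω => ω.2 t x) ω
        + (alg.pulls θ x t).indicator (fun _ => (x ⬝ᵥ (θ - θ')) ^ 2 / (2 * noiseVar S x)) ω)
      (alg.prob S) :=
    ((alg.integrable_pulls_noise S θ x t).const_mul _).add (hc x _)
  simp only [stoppedIncrement_eq]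
  rw [integral_finsetSum _ fun x _ => hi x]
  refine Finset.sum_congr rfl fun x _ => ?_
  rw [integral_add ((alg.integrable_pulls_noise S θ x t).const_mul _) (hc x _),
    integral_const_mul, integral_pulls_noise, mul_zero, zero_add,
    integral_indicator_const _ (alg.measurableSet_pulls θ x t), smul_eq_mul]

/-! ### The information inequality -/

/-- The change-of-measure inequality for the event that `H` is returned. -/
theorem le_sum_expectedPulls (alg : Algorithm X U) (S : Matrix (Fin d) (Fin d) ℝ)
    (hσ : ∀ x ∈ X, 0 < noiseVar S x) (θ θ' : Fin d → ℝ) (H : Set (Fin d → ℝ)) {c : ℝ}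
    (hc : 0 ≤ c) (hfin : ∀ x, alg.expectedPulls S θ x ≠ ∞) :
    c * (alg.prob S).real {ω | alg.Returns θ H ω}
        - Real.log (1 + (Real.exp c - 1) * (alg.prob S).real {ω | alg.Returns θ' H ω})
      ≤ ∑ x : X, (alg.expectedPulls S θ x).toReal
          * ((x ⬝ᵥ (θ - θ')) ^ 2 / (2 * noiseVar S x)) := by
  set K : ℝ := 1 + (Real.exp c - 1) * (alg.prob S).real {ω | alg.Returns θ' H ω} with hK
  have hc1 : 0 ≤ Real.exp c - 1 := by linarith [Real.add_one_le_exp c]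
  have hKpos : 0 < K := by
    have := mul_nonneg hc1 (measureReal_nonneg (μ := alg.prob S) (s := {ω | alg.Returns θ' H ω}))
    linarith
  have hbound : ∀ n, c * ∑ t ∈ Finset.range n, (alg.prob S).real (alg.returnsAt θ H t)
      - Real.log K ≤ ∑ x : X, (alg.expectedPulls S θ x).toReal
          * ((x ⬝ᵥ (θ - θ')) ^ 2 / (2 * noiseVar S x)) := by
    intro n
    let W : U × (ℕ → X → ℝ) → ℝ := fun ω => ∑ t ∈ Finset.range n,
      (alg.reward θ H c t ω - alg.stoppedIncrement S θ θ' t ω)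
    have hr : ∀ t, Integrable (alg.reward θ H c t) (alg.prob S) := fun t => by
      rw [reward_eq_indicator]
      exact (integrable_const _).indicator (alg.measurableSet_returnsAt θ H t)
    have hW : Integrable W (alg.prob S) := integrable_finsetSum _ fun t _ =>
      (hr t).sub (alg.integrable_stoppedIncrement S θ θ' t)
    have hle : ∫⁻ ω, ENNReal.ofReal (Real.exp (W ω)) ∂(alg.prob S) ≤ ENNReal.ofReal K :=
      (alg.lintegral_exp_sum_reward_sub S hσ θ θ' H c n).trans_le
        (alg.lintegral_exp_sum_reward_le S θ' H hc n)
    have hem : AEStronglyMeasurable (fun ω => Real.exp (W ω)) (alg.prob S) :=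
      Real.continuous_exp.comp_aestronglyMeasurable hW.aestronglyMeasurable
    have hnn : 0 ≤ᵐ[alg.prob S] fun ω => Real.exp (W ω) :=
      Filter.Eventually.of_forall fun ω => Real.exp_nonneg _
    have hei : Integrable (fun ω => Real.exp (W ω)) (alg.prob S) := by
      refine ⟨hem, ?_⟩
      rw [hasFiniteIntegral_iff_ofReal hnn]
      exact hle.trans_lt ENNReal.ofReal_lt_top
    have hexp : ∫ ω, Real.exp (W ω) ∂(alg.prob S) ≤ K := by
      rw [integral_eq_lintegral_of_nonneg_ae hnn hem]
      exact ENNReal.toReal_le_of_le_ofReal hKpos.le hle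
    -- Jensen's inequality for exp, obtained by integrating 1 + y ≤ exp y at y = W - log K.
    have hjensen : ∫ ω, W ω ∂(alg.prob S) ≤ Real.log K := by
      have h1 : ∫ ω, (1 + (W ω - Real.log K)) ∂(alg.prob S)
          ≤ ∫ ω, Real.exp (W ω) / K ∂(alg.prob S) := by
        refine integral_mono ((integrable_const _).add (hW.sub (integrable_const _)))
          (hei.div_const _) fun ω => ?_
        have := Real.add_one_le_exp (W ω - Real.log K)
        rw [Real.exp_sub, Real.exp_log hKpos] at this
        simpa [add_comm] using this
      have hWK : Integrable (fun ω => W ω - Real.log K) (alg.prob S) :=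
        hW.sub (integrable_const _)
      rw [integral_add (integrable_const _) hWK,
        integral_sub hW (integrable_const _), integral_div] at h1
      simp only [integral_const, probReal_univ, one_smul] at h1
      have h2 := (div_le_one hKpos).2 hexp
      linarith
    have hWint : ∫ ω, W ω ∂(alg.prob S)
        = c * ∑ t ∈ Finset.range n, (alg.prob S).real (alg.returnsAt θ H t)
          - ∑ x : X, (∑ t ∈ Finset.range n, (alg.prob S).real (alg.pulls θ x t))
            * ((x ⬝ᵥ (θ - θ')) ^ 2 / (2 * noiseVar S x)) := by
      have hi : ∀ t, Integrable (fun ω => alg.reward θ H c t ω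
          - alg.stoppedIncrement S θ θ' t ω) (alg.prob S) := fun t =>
        (hr t).sub (alg.integrable_stoppedIncrement S θ θ' t)
      simp only [W]
      rw [integral_finsetSum _ fun t _ => hi t]
      simp only [Finset.sum_mul]
      rw [Finset.sum_comm, Finset.mul_sum, ← Finset.sum_sub_distrib]
      refine Finset.sum_congr rfl fun t _ => ?_
      rw [integral_sub (hr t) (alg.integrable_stoppedIncrement S θ θ' t),
        integral_stoppedIncrement, reward_eq_indicator,
        integral_indicator_const _ (alg.measurableSet_returnsAt θ H t), smul_eq_mul, mul_comm c]
    have hpulls : ∑ x : X, (∑ t ∈ Finset.range n, (alg.prob S).real (alg.pulls θ x t))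
            * ((x ⬝ᵥ (θ - θ')) ^ 2 / (2 * noiseVar S x))
        ≤ ∑ x : X, (alg.expectedPulls S θ x).toReal
          * ((x ⬝ᵥ (θ - θ')) ^ 2 / (2 * noiseVar S x)) := by
      refine Finset.sum_le_sum fun x _ => mul_le_mul_of_nonneg_right ?_ ?_
      · simp only [Measure.real]
        rw [← ENNReal.toReal_sum fun t _ => measure_ne_top _ _]
        exact ENNReal.toReal_mono (hfin x) (ENNReal.sum_le_tsum _)
      · have := hσ x x.2
        positivity
    linarith
  refine le_of_tendsto' (((alg.hasSum_returnsAt S θ H).tendsto_sum_nat.const_mul c).sub_const _)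
    hbound

end Algorithm
-- A numerical bound on the binary relative entropy
lemma add_one_sub_div_le_log {a t : ℝ} (ha : 0 < a) (ht : 0 < t) :
    Real.log a + (1 - a / t) ≤ Real.log t := by
  have := Real.one_sub_inv_le_log_of_pos (div_pos ht ha)
  rw [Real.log_div ht.ne' ha.ne', inv_div] at this
  linarith

/-- A lower bound for the binary relative entropy of `1 - δ` and `δ`. -/
lemma log_inv_le_binary_relative_entropy {δ : ℝ} (h0 : 0 < δ) (h1 : δ < 5 / 12) :
    Real.log (1 / (2.4 * δ)) ≤ (1 - 2 * δ) * Real.log ((1 - δ) / δ) := by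
  have hu : 0 < 1 - δ := by linarith
  rw [Real.log_div hu.ne' h0.ne', one_div, Real.log_inv, Real.log_mul (by norm_num) h0.ne']
  -- The difference of the two sides, 2δ log δ + (1-2δ) log(1-δ) + log 2.4, equals 2(δ log δ + (1-δ)
  -- log(1-δ)) - log(1-δ) + log 2.4 and is convex in δ. It is bounded below by its tangent at δ =
  -- 8/25. This affine function is nonnegative at the ends 0 and 5/12, where its values are the
  -- expression in `e0` and one sixth of that in `e1`.
  have t1 := add_one_sub_div_le_log (a := 8 / 25) (by norm_num) h0
  have t2 := add_one_sub_div_le_log (a := 17 / 25) (by norm_num) hu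
  have t3 := Real.log_le_sub_one_of_pos (div_pos hu (by norm_num : (0:ℝ) < 17 / 25))
  rw [Real.log_div hu.ne' (by norm_num)] at t3
  have t1' : δ * Real.log (8 / 25) + (δ - 8 / 25) ≤ δ * Real.log δ := by
    have := mul_le_mul_of_nonneg_left t1 h0.le
    rw [mul_add, mul_sub, mul_div_cancel₀ _ h0.ne'] at this
    linarith
  have t2' : (1 - δ) * Real.log (17 / 25) + ((1 - δ) - 17 / 25) ≤ (1 - δ) * Real.log (1 - δ) := by
    have := mul_le_mul_of_nonneg_left t2 hu.le
    rw [mul_add, mul_sub, mul_div_cancel₀ _ hu.ne'] at this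
    linarith
  have e0 : 0 ≤ Real.log (17 / 25) + (1 - 25 / 17) + Real.log 2.4 := by
    rw [add_right_comm, ← Real.log_mul (by norm_num) (by norm_num)]
    have : (8 / 17 : ℝ) ≤ Real.log (17 / 25 * 2.4) := by
      rw [Real.le_log_iff_exp_le (by norm_num)]
      refine le_of_pow_le_pow_left₀ (n := 17) (by norm_num) (by norm_num) ?_
      rw [← Real.exp_nat_mul]
      calc Real.exp ((17 : ℕ) * (8 / 17)) = Real.exp 1 ^ 8 := by
            rw [← Real.exp_nat_mul]; norm_num
        _ ≤ 2.7182818286 ^ 8 := by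
            gcongr; exact Real.exp_one_lt_d9.le
        _ ≤ _ := by norm_num
    linarith
  have e1 : 0 ≤ 5 * Real.log (8 / 25) + Real.log (17 / 25) + 29 / 34 + 6 * Real.log 2.4 := by
    have h5 : 5 * Real.log (8 / 25) = Real.log ((8 / 25) ^ 5) := by rw [Real.log_pow]; norm_num
    have h6 : 6 * Real.log 2.4 = Real.log (2.4 ^ 6) := by rw [Real.log_pow]; norm_num
    rw [h5, h6, add_right_comm, ← Real.log_mul (by norm_num) (by norm_num),
      ← Real.log_mul (by norm_num) (by norm_num)]
    have : Real.log (((8 / 25) ^ 5 * (17 / 25) * 2.4 ^ 6)⁻¹) ≤ 29 / 34 := by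
      rw [Real.log_le_iff_le_exp (by norm_num)]
      refine le_trans ?_ (Real.sum_le_exp_of_nonneg (x := 29 / 34) (by norm_num) 4)
      norm_num [Finset.sum_range_succ, Nat.factorial]
    rw [Real.log_inv] at this
    linarith
  have hA := mul_nonneg (by linarith : 0 ≤ 5 / 12 - δ) e0
  have hB := mul_nonneg h0.le e1
  nlinarith [t1', t2', t3, hA, hB]

/-! ### The information matrix -/

lemma infoMatrix_mulVec {d : ℕ} (X : Finset (Fin d → ℝ)) (S : Matrix (Fin d) (Fin d) ℝ)
    (l : X → ℝ) (u : Fin d → ℝ) :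
    infoMatrix X S l *ᵥ u
      = ∑ x : X, (l x * (noiseVar S x)⁻¹ * ((x : Fin d → ℝ) ⬝ᵥ u)) • (x : Fin d → ℝ) := by
  unfold infoMatrix
  rw [Matrix.sum_mulVec]
  refine Finset.sum_congr rfl fun x _ => ?_
  rw [smul_mulVec, vecMulVec_mulVec, op_smul_eq_smul, smul_smul]

lemma dotProduct_infoMatrix_mulVec {d : ℕ} (X : Finset (Fin d → ℝ))
    (S : Matrix (Fin d) (Fin d) ℝ) (l : X → ℝ) (u : Fin d → ℝ) :
    u ⬝ᵥ (infoMatrix X S l *ᵥ u)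
      = ∑ x : X, l x * (noiseVar S x)⁻¹ * ((x : Fin d → ℝ) ⬝ᵥ u) ^ 2 := by
  rw [infoMatrix_mulVec, dotProduct_sum]
  refine Finset.sum_congr rfl fun x _ => ?_
  rw [dotProduct_smul, dotProduct_comm u, smul_eq_mul]
  ring

lemma eq_zero_of_dotProduct_eq_zero {d : ℕ} {X : Finset (Fin d → ℝ)}
    (hX : Submodule.span ℝ (X : Set (Fin d → ℝ)) = ⊤) {v : Fin d → ℝ}
    (h : ∀ x ∈ X, x ⬝ᵥ v = 0) : v = 0 := by
  have hv : v ∈ Submodule.span ℝ (X : Set (Fin d → ℝ)) := hX ▸ Submodule.mem_top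
  have : v ⬝ᵥ v = 0 := by
    refine Submodule.span_induction (p := fun y _ => y ⬝ᵥ v = 0) (fun y hy => h y hy) (by simp)
      (fun y z _ _ hy hz => ?_) (fun c y _ hy => ?_) hv
    · rw [add_dotProduct, hy, hz, add_zero]
    · rw [smul_dotProduct, hy, smul_zero]
  exact dotProduct_self_eq_zero.1 this

/-- A kernel vector annihilates the quadratic form, a sum of squares with positive weights; it is
then orthogonal to the spanning set X. -/
lemma isUnit_infoMatrix {d : ℕ} {X : Finset (Fin d → ℝ)}
    (hX : Submodule.span ℝ (X : Set (Fin d → ℝ)) = ⊤) {S : Matrix (Fin d) (Fin d) ℝ}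
    (hσ : ∀ x ∈ X, 0 < noiseVar S x) {l : X → ℝ} (hl : ∀ x, 0 < l x) :
    IsUnit (infoMatrix X S l) := by
  rw [← Matrix.mulVec_injective_iff_isUnit]
  refine (injective_iff_map_eq_zero (infoMatrix X S l).mulVecLin).2 fun v hv => ?_
  have hq := dotProduct_infoMatrix_mulVec X S l v
  rw [show infoMatrix X S l *ᵥ v = 0 from hv, dotProduct_zero] at hq
  have hpos : ∀ x : X, 0 < l x * (noiseVar S x)⁻¹ := fun x =>
    mul_pos (hl x) (inv_pos.2 (hσ x x.2))
  have h0 := (Finset.sum_eq_zero_iff_of_nonneg fun x _ =>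
    mul_nonneg (hpos x).le (sq_nonneg _)).1 hq.symm
  refine eq_zero_of_dotProduct_eq_zero hX fun x hx => ?_
  have := h0 ⟨x, hx⟩ (Finset.mem_univ _)
  exact pow_eq_zero_iff two_ne_zero |>.1 ((mul_eq_zero.1 this).resolve_left (hpos ⟨x, hx⟩).ne')

/-! ### Well-posed alternatives near a boundary point -/

lemma exists_dotProduct_ne_zero {d : ℕ} (F : Finset (Fin d → ℝ)) (hF : ∀ w ∈ F, w ≠ 0) :
    ∃ v : Fin d → ℝ, ∀ w ∈ F, w ⬝ᵥ v ≠ 0 := by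
  obtain ⟨f, hf⟩ := Module.exists_dual_forall_apply_ne_zero (K := ℝ)
    (fun w : F => (w : Fin d → ℝ)) fun w => hF w w.2
  refine ⟨fun i => f (Pi.single i 1), fun w hw => ?_⟩
  have := hf ⟨w, hw⟩
  rwa [show f w = w ⬝ᵥ fun i => f (Pi.single i 1) by
    conv_lhs => rw [pi_eq_sum_univ' w]
    simp [dotProduct]] at this

lemma eventually_dotProduct_ne {d : ℕ} {w v : Fin d → ℝ} (h : w ⬝ᵥ v ≠ 0) (θ : Fin d → ℝ)
    (a : ℝ) : ∀ᶠ t : ℝ in nhdsWithin 0 (Set.Ioi 0), w ⬝ᵥ (θ + t • v) ≠ a := by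
  have : ∀ᶠ t : ℝ in nhdsWithin 0 (Set.Ioi 0), t ≠ (a - w ⬝ᵥ θ) / (w ⬝ᵥ v) := by
    by_cases hc : (a - w ⬝ᵥ θ) / (w ⬝ᵥ v) = 0
    · filter_upwards [self_mem_nhdsWithin] with t ht
      rw [hc]; exact (Set.mem_Ioi.1 ht).ne'
    · exact nhdsWithin_le_nhds (isOpen_ne.mem_nhds (Ne.symm hc))
  filter_upwards [this] with t ht heq
  refine ht ?_
  rw [dotProduct_add, dotProduct_smul, smul_eq_mul] at heq
  rw [eq_div_iff h]
  linarith

namespace Objective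

variable {d : ℕ} {Z : Finset (Fin d → ℝ)}

lemma offset_lt_of_mem {θ : Fin d → ℝ} {obj : Objective} {h q : Fin d → ℝ}
    (hh : h ∈ obj.target Z θ) (hq : q ∈ obj.comparison Z θ) : obj.offset < (h - q) ⬝ᵥ θ := by
  cases obj with
  | BAI =>
    obtain ⟨hhZ, hmax⟩ := hh
    obtain ⟨hqZ, hqt⟩ := hq
    have : q ⬝ᵥ θ < h ⬝ᵥ θ := by
      by_contra hle
      exact hqt ⟨hqZ, fun z hz => (hmax z hz).trans (not_lt.1 hle)⟩
    simp only [offset, sub_dotProduct]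
    linarith
  | LS α =>
    have hq0 : q = 0 := hq
    simpa [offset, hq0] using hh.2

lemma mem_params_BAI {θ : Fin d → ℝ} (hZ : Z.Nonempty)
    (h : ∀ z ∈ Z, ∀ z' ∈ Z, z ≠ z' → (z - z') ⬝ᵥ θ ≠ 0) : θ ∈ Objective.BAI.params Z := by
  obtain ⟨z, hz, hmax⟩ := Z.exists_max_image (fun z => z ⬝ᵥ θ) hZ
  refine ⟨z, ⟨hz, hmax⟩, fun z' hz' => ?_⟩
  by_contra hne
  refine h z' hz'.1 z hz hne ?_
  rw [sub_dotProduct, sub_eq_zero]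
  exact le_antisymm (hmax z' hz'.1) (hz'.2 z hz)

/-- A point on the boundary of an alternative is approached by well-posed parameters at which
another set has to be identified. -/
lemma exists_eventually_alternative {θ : Fin d → ℝ} {obj : Objective} (hθ : θ ∈ obj.params Z)
    {h q : Fin d → ℝ} (hh : h ∈ obj.target Z θ) (hq : q ∈ obj.comparison Z θ) (hw : h - q ≠ 0)
    {θ₀ : Fin d → ℝ} (h₀ : (h - q) ⬝ᵥ θ₀ = obj.offset) :
    ∃ v : Fin d → ℝ, ∀ᶠ t : ℝ in nhdsWithin 0 (Set.Ioi 0),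
      θ₀ + t • v ∈ obj.params Z ∧ obj.target Z (θ₀ + t • v) ≠ obj.target Z θ := by
  classical
  -- Normals of all hyperplanes on which well-posedness can fail (ties for `BAI`, the threshold for
  -- `LS`), together with h - q. A direction v transversal to all of them leaves these hyperplanes
  -- for small t > 0.
  let F : Finset (Fin d → ℝ) :=
    (insert (h - q) (Z ∪ (Z ×ˢ Z).image fun p => p.1 - p.2)).filter (· ≠ 0)
  obtain ⟨v, hv, hneg⟩ : ∃ v : Fin d → ℝ, (∀ w ∈ F, w ⬝ᵥ v ≠ 0) ∧ (h - q) ⬝ᵥ v < 0 := by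
    obtain ⟨v, hv⟩ := exists_dotProduct_ne_zero F (by simp [F])
    rcases lt_or_gt_of_ne (hv (h - q) (by simp [F, hw])) with hlt | hgt
    · exact ⟨v, hv, hlt⟩
    · exact ⟨-v, fun w hw => by simpa using hv w hw, by simpa using hgt⟩
  have hside : ∀ t : ℝ, 0 < t → (h - q) ⬝ᵥ (θ₀ + t • v) < obj.offset := by
    intro t ht
    rw [dotProduct_add, dotProduct_smul, smul_eq_mul, h₀]
    linarith [mul_neg_of_pos_of_neg ht hneg]
  refine ⟨v, ?_⟩
  have hev : ∀ᶠ t : ℝ in nhdsWithin 0 (Set.Ioi 0), ∀ w ∈ F, ∀ a ∈ ({0, obj.offset} : Finset ℝ),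
      w ⬝ᵥ (θ₀ + t • v) ≠ a := by
    rw [Filter.eventually_all_finset]
    intro w hwF
    rw [Filter.eventually_all_finset]
    exact fun a _ => eventually_dotProduct_ne (hv w hwF) θ₀ a
  filter_upwards [hev, self_mem_nhdsWithin] with t ht htpos
  have hs := hside t htpos
  cases obj with
  | BAI =>
    refine ⟨mem_params_BAI ⟨h, hh.1⟩ fun z hz z' hz' hne => ?_, fun heq => ?_⟩
    · refine ht (z - z') ?_ 0 (by simp)
      simp only [F, Finset.mem_filter, Finset.mem_insert, Finset.mem_union, Finset.mem_image,
        Finset.mem_product]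
      exact ⟨Or.inr (Or.inr ⟨(z, z'), ⟨hz, hz'⟩, rfl⟩), sub_ne_zero.2 hne⟩
    · have hmem : h ∈ Objective.BAI.target Z (θ₀ + t • v) := heq ▸ hh
      have := hmem.2 q hq.1
      simp only [sub_dotProduct, offset] at hs
      linarith
  | LS α =>
    have hq0 : q = 0 := hq
    subst hq0
    refine ⟨fun z hz => ?_, fun heq => ?_⟩
    -- The item 0 has value 0 under every parameter, so for it α ≠ 0 is inherited from `θ`.
    · by_cases hz0 : z = 0
      · have := hθ z hz
        simpa [hz0] using this
      · exact ht z (by simp [F, hz, hz0]) α (by simp [offset])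
    · have hmem : h ∈ (Objective.LS α).target Z (θ₀ + t • v) := heq ▸ hh
      have := hmem.2
      simp only [sub_zero, offset] at hs
      linarith

end Objective

/-! ### Lower bounds for δ-PAC algorithms -/

namespace Algorithm

variable {d : ℕ} {X : Finset (Fin d → ℝ)} {U : Type*} [MeasurableSpace U]

lemma IsPAC.log_le_of_target_ne {alg : Algorithm X U} {S : Matrix (Fin d) (Fin d) ℝ}
    {Z : Finset (Fin d → ℝ)} {obj : Objective} {δ : ℝ} (hPAC : alg.IsPAC S Z obj δ)
    (hσ : ∀ x ∈ X, 0 < noiseVar S x) (h0 : 0 < δ) (h1 : δ < 5 / 12) {θ θ' : Fin d → ℝ}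
    (hθ : θ ∈ obj.params Z) (hθ' : θ' ∈ obj.params Z)
    (hne : obj.target Z θ' ≠ obj.target Z θ) (hfin : ∀ x, alg.expectedPulls S θ x ≠ ∞) :
    Real.log (1 / (2.4 * δ)) ≤ ∑ x : X, (alg.expectedPulls S θ x).toReal
          * ((x ⬝ᵥ (θ - θ')) ^ 2 / (2 * noiseVar S x)) := by
  have hu : 0 < 1 - δ := by linarith
  set r : ℝ := (1 - δ) / δ with hr
  have hr1 : 1 ≤ r := by rw [hr, le_div_iff₀ h0]; linarith
  have hr0 : 0 < r := by linarith
  have hlog : 0 ≤ Real.log r := Real.log_nonneg hr1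
  -- The choice c = 2 log r with r = (1-δ)/δ is optimal for the probabilities 1-δ and δ: since 1 +
  -- (r²-1)δ = r, the left side becomes (1-2δ) log r, the relative entropy.
  have hexp : Real.exp (2 * Real.log r) = r ^ 2 := by
    rw [two_mul, Real.exp_add, Real.exp_log hr0, sq]
  have hmain := alg.le_sum_expectedPulls S hσ θ θ' (obj.target Z θ)
    (mul_nonneg zero_le_two hlog) hfin
  set p := (alg.prob S).real {ω | alg.Returns θ (obj.target Z θ) ω} with hp
  set q := (alg.prob S).real {ω | alg.Returns θ' (obj.target Z θ) ω} with hq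
  have hp1 : 1 - δ ≤ p := (ENNReal.ofReal_le_iff_le_toReal (measure_ne_top _ _)).1 (hPAC θ hθ)
  have hq0 : 0 ≤ q := measureReal_nonneg
  have hq1 : q ≤ δ := by
    have hp' : 1 - δ ≤ (alg.prob S).real {ω | alg.Returns θ' (obj.target Z θ') ω} :=
      (ENNReal.ofReal_le_iff_le_toReal (measure_ne_top _ _)).1 (hPAC θ' hθ')
    have hu := measureReal_union (μ := alg.prob S) (alg.disjoint_returns θ' hne)
      (alg.measurableSet_returns θ' (obj.target Z θ))
    have := measureReal_le_one (μ := alg.prob S)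
      (s := {ω | alg.Returns θ' (obj.target Z θ') ω} ∪ {ω | alg.Returns θ' (obj.target Z θ) ω})
    linarith
  have hr2 : 0 ≤ r ^ 2 - 1 := by nlinarith
  have hK : Real.log (1 + (Real.exp (2 * Real.log r) - 1) * q) ≤ Real.log r := by
    rw [hexp]
    refine Real.log_le_log (by nlinarith [mul_nonneg hr2 hq0]) ?_
    have h2 : 1 + (r ^ 2 - 1) * δ = r := by
      rw [hr]; field_simp; ring
    nlinarith [mul_le_mul_of_nonneg_left hq1 hr2]
  have hkl := log_inv_le_binary_relative_entropy h0 h1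
  nlinarith [mul_le_mul_of_nonneg_left hp1 (mul_nonneg zero_le_two hlog)]

/-- The right side is continuous in the alternative, and θ₀ is a limit of admissible ones; θ₀ itself
is not one in general. -/
lemma IsPAC.log_le_of_boundary {alg : Algorithm X U} {S : Matrix (Fin d) (Fin d) ℝ}
    {Z : Finset (Fin d → ℝ)} {obj : Objective} {δ : ℝ} (hPAC : alg.IsPAC S Z obj δ)
    (hσ : ∀ x ∈ X, 0 < noiseVar S x) (h0 : 0 < δ) (h1 : δ < 5 / 12) {θ θ₀ : Fin d → ℝ}
    (hθ : θ ∈ obj.params Z) {h q : Fin d → ℝ} (hh : h ∈ obj.target Z θ)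
    (hq : q ∈ obj.comparison Z θ) (hw : h - q ≠ 0) (h₀ : (h - q) ⬝ᵥ θ₀ = obj.offset)
    (hfin : ∀ x, alg.expectedPulls S θ x ≠ ∞) :
    Real.log (1 / (2.4 * δ)) ≤ ∑ x : X, (alg.expectedPulls S θ x).toReal
          * ((x ⬝ᵥ (θ - θ₀)) ^ 2 / (2 * noiseVar S x)) := by
  obtain ⟨v, hv⟩ := Objective.exists_eventually_alternative hθ hh hq hw h₀
  have hcont : Continuous fun t : ℝ => ∑ x : X, (alg.expectedPulls S θ x).toReal
          * ((x ⬝ᵥ (θ - (θ₀ + t • v))) ^ 2 / (2 * noiseVar S x)) := by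
    simp only [dotProduct_sub, dotProduct_add, dotProduct_smul, smul_eq_mul]
    fun_prop
  have hlim := (hcont.tendsto 0).mono_left (nhdsWithin_le_nhds (s := Set.Ioi 0))
  simp only [zero_smul, add_zero] at hlim
  refine ge_of_tendsto hlim ?_
  filter_upwards [hv] with t ht
  exact hPAC.log_le_of_target_ne hσ h0 h1 hθ ht.1 ht.2 hfin

lemma IsPAC.mul_ratio_le {alg : Algorithm X U} {S : Matrix (Fin d) (Fin d) ℝ}
    {Z : Finset (Fin d → ℝ)} {obj : Objective} {δ : ℝ} (hPAC : alg.IsPAC S Z obj δ)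
    (hσ : ∀ x ∈ X, 0 < noiseVar S x) (h0 : 0 < δ) (h1 : δ < 5 / 12) {θ : Fin d → ℝ}
    (hθ : θ ∈ obj.params Z) {h q : Fin d → ℝ} (hh : h ∈ obj.target Z θ)
    (hq : q ∈ obj.comparison Z θ) (hfin : ∀ x, alg.expectedPulls S θ x ≠ ∞)
    {l : X → ℝ} (hl : ∀ x, 0 ≤ l x) (hunit : IsUnit (infoMatrix X S l)) {s : ℝ} (hs : 0 ≤ s)
    (hsl : ∀ x, (alg.expectedPulls S θ x).toReal ≤ s * l x) :
    2 * Real.log (1 / (2.4 * δ)) * (((h - q) ⬝ᵥ ((infoMatrix X S l)⁻¹ *ᵥ (h - q))) /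
        ((h - q) ⬝ᵥ θ - obj.offset) ^ 2) ≤ s := by
  -- This occurs for `LS` with negative threshold and h = 0. No alternative moves that item across
  -- the threshold, but the ratio is 0.
  by_cases hw : h - q = 0
  · simpa [hw] using hs
  set w := h - q with hwdef
  set g := w ⬝ᵥ θ - obj.offset with hg
  have hgpos : 0 < g := sub_pos.2 (Objective.offset_lt_of_mem hh hq)
  set u := (infoMatrix X S l)⁻¹ *ᵥ w with hu
  have hAu : infoMatrix X S l *ᵥ u = w := by
    rw [hu, mulVec_mulVec, mul_nonsing_inv _ ((isUnit_iff_isUnit_det _).1 hunit), one_mulVec]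
  have hwu : w ⬝ᵥ u = ∑ x : X, l x * (noiseVar S x)⁻¹ * ((x : Fin d → ℝ) ⬝ᵥ u) ^ 2 := by
    rw [← dotProduct_infoMatrix_mulVec, hAu, dotProduct_comm]
  have hnn : ∀ x : X, 0 ≤ l x * (noiseVar S x)⁻¹ * ((x : Fin d → ℝ) ⬝ᵥ u) ^ 2 := fun x =>
    mul_nonneg (mul_nonneg (hl x) (inv_pos.2 (hσ x x.2)).le) (sq_nonneg _)
  have hpos : 0 < w ⬝ᵥ u := by
    refine lt_of_le_of_ne (hwu ▸ Finset.sum_nonneg fun x _ => hnn x) fun hz => hw ?_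
    have hz' := (Finset.sum_eq_zero_iff_of_nonneg fun x _ => hnn x).1 (hwu.symm.trans hz.symm)
    rw [← hAu, infoMatrix_mulVec]
    refine Finset.sum_eq_zero fun x hx => ?_
    rcases mul_eq_zero.1 (hz' x hx) with h2 | h2
    · simp [h2]
    · simp [pow_eq_zero_iff two_ne_zero |>.1 h2]
  -- The displacement k • u makes θ - k • u meet the boundary. Among displacements v with wᵀv = g it
  -- minimizes vᵀA(λ)v, and the minimum is g²/(wᵀA(λ)⁻¹w), the inverse of the ratio.
  set k := g / (w ⬝ᵥ u) with hk
  have hkwu : k * (w ⬝ᵥ u) = g := div_mul_cancel₀ _ hpos.ne'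
  have hb := hPAC.log_le_of_boundary hσ h0 h1 (θ₀ := θ - k • u) hθ hh hq hw
    (by rw [dotProduct_sub, dotProduct_smul, smul_eq_mul, ← hwdef, hkwu, hg]; ring) hfin
  have hle : ∑ x : X, (alg.expectedPulls S θ x).toReal
      * ((x ⬝ᵥ (θ - (θ - k • u))) ^ 2 / (2 * noiseVar S x)) ≤ s * k ^ 2 / 2 * (w ⬝ᵥ u) := by
    rw [hwu, Finset.mul_sum]
    refine Finset.sum_le_sum fun x _ => ?_
    have hx := hσ x x.2
    calc _ ≤ (s * l x) * ((x ⬝ᵥ (θ - (θ - k • u))) ^ 2 / (2 * noiseVar S x)) :=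
          mul_le_mul_of_nonneg_right (hsl x) (by positivity)
      _ = _ := by
          rw [sub_sub_cancel, dotProduct_smul, smul_eq_mul]
          field_simp
  have hfinal : 2 * Real.log (1 / (2.4 * δ)) ≤ s * (g ^ 2 / (w ⬝ᵥ u)) := by
    have : s * k ^ 2 / 2 * (w ⬝ᵥ u) = s * (g ^ 2 / (w ⬝ᵥ u)) / 2 := by
      rw [hk]; field_simp
    linarith
  rw [mul_div_assoc', div_le_iff₀ (by positivity)]
  calc _ ≤ s * (g ^ 2 / (w ⬝ᵥ u)) * (w ⬝ᵥ u) := mul_le_mul_of_nonneg_right hfinal hpos.le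
    _ = _ := by field_simp

end Algorithm
end HetBandit

/-! ### The theorem: choice of the design -/

theorem theorem2 {d : ℕ} (X Z : Finset (Fin d → ℝ))
    (hX : Submodule.span ℝ (X : Set (Fin d → ℝ)) = ⊤)
    (S : Matrix (Fin d) (Fin d) ℝ) (hS : S.PosSemidef)
    (hσ : ∀ x ∈ X, 0 < HetBandit.noiseVar S x)
    (obj : HetBandit.Objective) (δ : ℝ) (hδ0 : 0 < δ) (hδ1 : δ < 1)
    {U : Type*} [MeasurableSpace U] (alg : HetBandit.Algorithm X U)
    (hPAC : alg.IsPAC S Z obj δ)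
    (θ : Fin d → ℝ) (hθ : θ ∈ obj.params Z) :
    ENNReal.ofReal (2 * Real.log (1 / (2.4 * δ))) * HetBandit.complexity X Z S θ obj
      ≤ alg.expectedTau S θ := by
  -- 5/12 = 1/2.4 is where the logarithm changes sign.
  by_cases hδ : δ < 5 / 12
  swap
  · have : Real.log (1 / (2.4 * δ)) ≤ 0 := by
      refine Real.log_nonpos (by positivity) ?_
      rw [div_le_one (by positivity)]
      linarith
    rw [ENNReal.ofReal_of_nonpos (by linarith), zero_mul]
    exact zero_le
  have hsum := alg.sum_expectedPulls_le S θ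
  have hne : Nonempty X := by
    have := alg.isProbabilityMeasure_seed
    obtain ⟨u⟩ := nonempty_of_isProbabilityMeasure alg.seed
    exact ⟨alg.arm 0 (u, Fin.elim0)⟩
  have hcard : (0 : ℝ) < Fintype.card X := by exact_mod_cast Fintype.card_pos
  refine ENNReal.le_of_forall_pos_le_add fun e he htop => ?_
  have hfin : ∀ x, alg.expectedPulls S θ x ≠ ∞ := fun x =>
    ((Finset.single_le_sum (fun _ _ => zero_le) (Finset.mem_univ x)).trans hsum).trans_lt
      htop |>.ne
  set T : X → ℝ := fun x => (alg.expectedPulls S θ x).toReal with hT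
  have hT0 : ∀ x, 0 ≤ T x := fun x => ENNReal.toReal_nonneg
  -- The slack e is spread evenly over the arms, so that every weight of the normalized pull counts
  -- is positive even for arms never pulled.
  set ε : ℝ := e / Fintype.card X with hε
  have hε0 : 0 < ε := div_pos he hcard
  set s : ℝ := ∑ x, T x + e with hs
  have hs0 : 0 < s := add_pos_of_nonneg_of_pos (Finset.sum_nonneg fun x _ => hT0 x) he
  set l : X → ℝ := fun x => (T x + ε) / s with hl
  have hlpos : ∀ x, 0 < l x := fun x => div_pos (add_pos_of_nonneg_of_pos (hT0 x) hε0) hs0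
  have hlmem : l ∈ stdSimplex ℝ X := by
    refine ⟨fun x => (hlpos x).le, ?_⟩
    rw [hl, ← Finset.sum_div, div_eq_one_iff_eq hs0.ne', Finset.sum_add_distrib,
      Finset.sum_const, Finset.card_univ, nsmul_eq_mul, hε, mul_div_cancel₀ _ hcard.ne']
  have hunit := HetBandit.isUnit_infoMatrix hX hσ hlpos
  have hsl : ∀ x, T x ≤ s * l x := fun x => by
    rw [hl, mul_div_cancel₀ _ hs0.ne']; linarith
  calc ENNReal.ofReal (2 * Real.log (1 / (2.4 * δ))) * HetBandit.complexity X Z S θ obj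
      ≤ ENNReal.ofReal (2 * Real.log (1 / (2.4 * δ))) *
          ⨆ h ∈ obj.target Z θ, ⨆ q ∈ obj.comparison Z θ,
            ENNReal.ofReal (((h - q) ⬝ᵥ ((HetBandit.infoMatrix X S l)⁻¹ *ᵥ (h - q))) /
              ((h - q) ⬝ᵥ θ - obj.offset) ^ 2) := by
        gcongr
        exact iInf₂_le_of_le l hlmem (iInf_le _ hunit)
    _ ≤ ENNReal.ofReal s := by
        simp only [ENNReal.mul_iSup]
        refine iSup₂_le fun h hh => iSup₂_le fun q hq => ?_
        have hlog : 0 ≤ Real.log (1 / (2.4 * δ)) := by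
          refine Real.log_nonneg ?_
          rw [le_div_iff₀ (by positivity)]
          linarith
        rw [← ENNReal.ofReal_mul (by linarith)]
        exact ENNReal.ofReal_le_ofReal (hPAC.mul_ratio_le hσ hδ0 hδ hθ hh hq hfin
          (fun x => (hlpos x).le) hunit hs0.le hsl)
    _ = ∑ x, alg.expectedPulls S θ x + e := by
        rw [hs, ENNReal.ofReal_add (Finset.sum_nonneg fun x _ => hT0 x) e.coe_nonneg,
          ENNReal.ofReal_sum_of_nonneg fun x _ => hT0 x, ENNReal.ofReal_coe_nnreal]
        simp only [hT, ENNReal.ofReal_toReal (hfin _)]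
    _ ≤ alg.expectedTau S θ + e := by gcongr
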